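/- Let $\mathfrak g$ be the Lie algebra of a compact semisimple Lie group, with generators $t^a$, $[t^a,t^b]=f^{abc}t^c$, $\mathrm{tr}(t^at^b)=-2\delta^{ab}$ ($\mathrm{tr}$ is the Killing form; repeated indices are summed). Let $(M,g)$ be a smooth Riemannian manifold of dimension $d$, and let $U\subset M$ be a convex open domain (a normal neighbourhood of each of its points) with coordinates $x^\mu$ defined on $U$. Let $B_\mu=B_\mu^at^a\in C^\infty(U,\mathfrak g)$ be the components of a connection $1$-form; write $\mathbf B_\mu$ for the matrix with entries $f^{adb}B^d_\mu$. For $x,y\in U$ let $\gamma:[u_0,u_1]\to U$, $u_0<u_1$, be the geodesic with $\gamma(u_0)=y$, $\gamma(u_1)=x$, and let $$\Phi(x,y)=\mathbf 1+\sum_{k\ge1}(-1)^k\int_{u_0}^{u_1}ds_1\cdots\int_{u_0}^{s_{k-1}}ds_k\,\dot\gamma^{\mu_1}(s_1)\mathbf B_{\mu_1}(\gamma(s_1))\cdots\dot\gamma^{\mu_k}(s_k)\mathbf B_{\mu_k}(\gamma(s_k))$$ be the path-ordered exponential. Let $\sigma(x,y)$ be half the square of the length of the geodesic in $U$ from $x$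 to $y$, $\sigma^\rho=g^{\rho\nu}(x)\partial_{x^\nu}\sigma$ and $\sigma^{\rho'}=\partial_{y^{\nu'}}\sigma\,g^{\nu'\rho'}(y)$. Let $N_r(x,y)$ and $N_l(x,y)$ be the operators on matrix-valued functions $h$ of $x\in U$ ($y$ fixed), respectively of $y\in U$ ($x$ fixed), given by $$N_rh=\sigma^\rho(x,y)\big(\partial_{x^\rho}h+\mathbf B_\rho(x)h\big),\qquad hN_l=\big(\partial_{y^{\rho'}}h-h\mathbf B_{\rho'}(y)\big)\sigma^{\rho'}(x,y).$$ For such an operator $N$ and $\tau\le0$, $e^{\tau N}1$ denotes the value at $\tau$ of the solution $u$, of class $C^1$ on $(-\infty,0]\times U$, of $\partial_\tau u=Nu$, $u|_{\tau=0}=1$, where $1$ is the constant function equal to the unit matrix; for $N=N_l$, which acts from the right, it is written $1\,e^{\tau N_l}$. Then the series for $\Phi(x,y)$ converges, for both operators this solution exists and is unique, and for all $x,y\in U$ $$\Phi(x,y)=\lim_{t\to1-0}\Big(e^{N_r(x,y)\ln(1-t)}\,1\Big)=\lim_{t\to1-0}\Big(1\,e^{N_l(x,y)\ln(1-t)}\Big).$$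 -/

import Mathlib

open Set Filter Topology MeasureTheory
open scoped Manifold ContDiff Matrix

namespace OrdExp

/-- The space of coordinate values. -/
abbrev Coord (d : ℕ) : Type := EuclideanSpace ℝ (Fin d)

/-! ### Lie algebra data -/

/-- Structure constants of a basis: `[t^a, t^b] = f^{abc} t^c`. -/
noncomputable def structConst {ι 𝔤 : Type*} [LieRing 𝔤] [LieAlgebra ℝ 𝔤]
    (t : Module.Basis ι ℝ 𝔤) (a b c : ι) : ℝ :=
  t.repr ⁅t a, t b⁆ c

/-- The matrix with entries `f^{adb} X^d` of an element `X = X^d t^d` of the Lie algebra. -/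
noncomputable def adjMatrix {ι 𝔤 : Type*} [Fintype ι] [LieRing 𝔤] [LieAlgebra ℝ 𝔤]
    (t : Module.Basis ι ℝ 𝔤) (X : 𝔤) : Matrix ι ι ℝ :=
  Matrix.of fun a b => ∑ k, structConst t a k b * t.repr X k

/-! ### Riemannian geometry in coordinates

`G z` is the matrix of metric components `g_{μν}` at the coordinate point `z`. -/

section Geometry

variable {d : ℕ}

/-- The partial derivative `∂_μ f`. -/
noncomputable def pd (μ : Fin d) (f : Coord d → ℝ) (z : Coord d) : ℝ :=
  fderiv ℝ f z (EuclideanSpace.single μ 1)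

/-- Components of a Riemannian metric in a chart `e`, as functions of the coordinates:
`g_{μν} = g(∂_μ, ∂_ν)`. -/
noncomputable def metricCoord {M : Type*} [TopologicalSpace M] [ChartedSpace (Coord d) M]
    [IsManifold (𝓡 d) ∞ M]
    (g : Bundle.ContMDiffRiemannianMetric (𝓡 d) ∞ (Coord d) (TangentSpace (𝓡 d) : M → Type _))
    (e : OpenPartialHomeomorph M (Coord d)) (z : Coord d) : Matrix (Fin d) (Fin d) ℝ :=
  Matrix.of fun μ ν =>
    g.inner (e.symm z)
      (mfderiv (𝓡 d) (𝓡 d) e.symm z (EuclideanSpace.single μ (1 : ℝ)))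
      (mfderiv (𝓡 d) (𝓡 d) e.symm z (EuclideanSpace.single ν (1 : ℝ)))

/-- Christoffel symbols of the second kind `Γ^ρ_{μν}`. -/
noncomputable def christoffel (G : Coord d → Matrix (Fin d) (Fin d) ℝ) (ρ μ ν : Fin d)
    (z : Coord d) : ℝ :=
  ∑ α, (G z)⁻¹ ρ α / 2 *
    (pd ν (fun w => G w α μ) z + pd μ (fun w => G w α ν) z - pd α (fun w => G w μ ν) z)

/-- The velocity of a curve defined on `[a, b]` (one-sided at the end points). -/
noncomputable def velocity (a b : ℝ) (γ : ℝ → Coord d) (s : ℝ) : Coord d :=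
  derivWithin γ (Icc a b) s

/-- `γ : [a, b] → V` is a (possibly constant) affinely parameterized geodesic. -/
structure IsGeodesic (G : Coord d → Matrix (Fin d) (Fin d) ℝ) (V : Set (Coord d)) (a b : ℝ)
    (γ : ℝ → Coord d) : Prop where
  mapsTo : MapsTo γ (Icc a b) V
  contDiffOn : ContDiffOn ℝ 2 γ (Icc a b)
  eqn : ∀ s ∈ Icc a b, ∀ ρ,
    derivWithin (fun r => velocity a b γ r ρ) (Icc a b) s
      + ∑ μ, ∑ ν, christoffel G ρ μ ν (γ s) * velocity a b γ s μ * velocity a b γ s ν = 0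

/-- `V` is a normal neighbourhood of `y`: the exponential map at `y` restricts to a smooth
diffeomorphism of a star-shaped open neighbourhood of `0` (the source of `φ`) onto `V`. That `φ` is
the exponential map is the requirement that `s ↦ φ (s v)`, `0 ≤ s ≤ 1`, is the geodesic with
initial point `y` and initial velocity `v`. -/
def IsNormalNhd (G : Coord d → Matrix (Fin d) (Fin d) ℝ) (V : Set (Coord d)) (y : Coord d) :
    Prop :=
  ∃ φ : OpenPartialHomeomorph (Coord d) (Coord d),
    (0 : Coord d) ∈ φ.source ∧ StarConvex ℝ 0 φ.source ∧ φ.target = V ∧ φ 0 = y ∧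
    ContDiffOn ℝ ∞ φ φ.source ∧ ContDiffOn ℝ ∞ φ.symm φ.target ∧
    ∀ v ∈ φ.source, IsGeodesic G V 0 1 (fun s => φ (s • v)) ∧
      velocity 0 1 (fun s => φ (s • v)) 0 = v

/-- A (geodesically) convex open set: a normal neighbourhood of each of its points. -/
def IsConvexDomain (G : Coord d → Matrix (Fin d) (Fin d) ℝ) (V : Set (Coord d)) : Prop :=
  IsOpen V ∧ ∀ y ∈ V, IsNormalNhd G V y

/-- The length of a curve on `[a, b]`. -/
noncomputable def curveLength (G : Coord d → Matrix (Fin d) (Fin d) ℝ) (a b : ℝ)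
    (γ : ℝ → Coord d) : ℝ :=
  ∫ s in a..b,
    Real.sqrt (∑ μ, ∑ ν, G (γ s) μ ν * velocity a b γ s μ * velocity a b γ s ν)

/-- The length of the geodesic in `V` joining `y` and `x`. In a convex domain there is exactly one
geodesic `[0, 1] → V` from `y` to `x`, so the set below has exactly one element. -/
noncomputable def geodesicDist (G : Coord d → Matrix (Fin d) (Fin d) ℝ) (V : Set (Coord d))
    (x y : Coord d) : ℝ :=
  sInf {L : ℝ | ∃ γ : ℝ → Coord d,
    IsGeodesic G V 0 1 γ ∧ γ 0 = y ∧ γ 1 = x ∧ curveLength G 0 1 γ = L}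

/-- Synge's world function: half the square of the geodesic length. -/
noncomputable def synge (G : Coord d → Matrix (Fin d) (Fin d) ℝ) (V : Set (Coord d))
    (x y : Coord d) : ℝ :=
  geodesicDist G V x y ^ 2 / 2

/-- `σ^ρ(x, y) = g^{ρν}(x) ∂_{x^ν} σ(x, y)`. -/
noncomputable def syngeLeft (G : Coord d → Matrix (Fin d) (Fin d) ℝ) (V : Set (Coord d))
    (ρ : Fin d) (x y : Coord d) : ℝ :=
  ∑ ν, (G x)⁻¹ ρ ν * pd ν (fun z => synge G V z y) x

/-- `σ^{ρ'}(x, y) = ∂_{y^{ν'}} σ(x, y) g^{ν'ρ'}(y)`. -/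
noncomputable def syngeRight (G : Coord d → Matrix (Fin d) (Fin d) ℝ) (V : Set (Coord d))
    (ρ : Fin d) (x y : Coord d) : ℝ :=
  ∑ ν, pd ν (fun z => synge G V x z) y * (G y)⁻¹ ν ρ

end Geometry

/-! ### Covariant derivatives, ordered exponential, operator exponential

`A μ z` is the matrix `f^{adb} B^d_μ(z)` of the component `B_μ` of the connection. -/

section Connection

variable {d : ℕ} {ι : Type*} [Fintype ι] [DecidableEq ι]

/-- The left-acting covariant derivative `D_ρ h = ∂_ρ h + B_ρ h` of a matrix-valued function. -/
noncomputable def covLeft (A : Fin d → Coord d → Matrix ι ι ℝ) (ρ : Fin d)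
    (h : Coord d → Matrix ι ι ℝ) (z : Coord d) : Matrix ι ι ℝ :=
  Matrix.of (fun a b => pd ρ (fun w => h w a b) z) + A ρ z * h z

/-- The right-acting covariant derivative `h D_ρ = ∂_ρ h - h B_ρ` of a matrix-valued function. -/
noncomputable def covRight (A : Fin d → Coord d → Matrix ι ι ℝ) (ρ : Fin d)
    (h : Coord d → Matrix ι ι ℝ) (z : Coord d) : Matrix ι ι ℝ :=
  Matrix.of (fun a b => pd ρ (fun w => h w a b) z) - h z * A ρ z

/-- The operator `N_r = σ^ρ(x, y) D_ρ`, acting on functions of the first argument `x`. -/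
noncomputable def Nr (G : Coord d → Matrix (Fin d) (Fin d) ℝ) (V : Set (Coord d))
    (A : Fin d → Coord d → Matrix ι ι ℝ) (y : Coord d)
    (h : Coord d → Matrix ι ι ℝ) (x : Coord d) : Matrix ι ι ℝ :=
  ∑ ρ, syngeLeft G V ρ x y • covLeft A ρ h x

/-- The operator `N_l = D_{ρ'} σ^{ρ'}(x, y)`, acting from the right on functions of the second
argument `y`. -/
noncomputable def Nl (G : Coord d → Matrix (Fin d) (Fin d) ℝ) (V : Set (Coord d))
    (A : Fin d → Coord d → Matrix ι ι ℝ) (x : Coord d)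
    (h : Coord d → Matrix ι ι ℝ) (y : Coord d) : Matrix ι ι ℝ :=
  ∑ ρ, syngeRight G V ρ x y • covRight A ρ h y

/-- The iterated integrals
`∫_{a}^{s} ds₁ ∫_{a}^{s₁} ds₂ ⋯ ∫_{a}^{s_{k-1}} ds_k K(s₁) K(s₂) ⋯ K(s_k)` (entrywise),
where `K(s) = γ'^μ(s) B_μ(γ(s))` and `γ` is a curve on `[a, b]`. -/
noncomputable def iterInt (A : Fin d → Coord d → Matrix ι ι ℝ) (a b : ℝ) (γ : ℝ → Coord d) :
    ℕ → ℝ → Matrix ι ι ℝ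
  | 0, _ => 1
  | k + 1, s => Matrix.of fun i j =>
      ∫ r in a..s, ((∑ μ, velocity a b γ r μ • A μ (γ r)) * iterInt A a b γ k r) i j

/-- The `k`-th term of the series defining the ordered exponential along `γ : [a, b] → V`. -/
noncomputable def orderedExpTerm (A : Fin d → Coord d → Matrix ι ι ℝ) (a b : ℝ)
    (γ : ℝ → Coord d) (k : ℕ) : Matrix ι ι ℝ :=
  (-1 : ℝ) ^ k • iterInt A a b γ k b

/-- The path-ordered exponential along the curve `γ` on `[a, b]`, from `γ a` to `γ b`. -/
noncomputable def orderedExp (A : Fin d → Coord d → Matrix ι ι ℝ) (a b : ℝ)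
    (γ : ℝ → Coord d) : Matrix ι ι ℝ :=
  ∑' k, orderedExpTerm A a b γ k

/-- `u τ = e^{τ N} h` on `V` for `τ ≤ 0`, where `N` is a first-order linear differential operator
on matrix-valued functions: `u` is a classical (jointly `C^1`) solution on `(-∞, 0] × V` of the
evolution equation `∂_τ u = N u` with `u = h` at `τ = 0`. -/
structure IsOperatorExp (V : Set (Coord d))
    (N : (Coord d → Matrix ι ι ℝ) → Coord d → Matrix ι ι ℝ)
    (h : Coord d → Matrix ι ι ℝ) (u : ℝ → Coord d → Matrix ι ι ℝ) : Prop where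
  contDiffOn : ∀ i j, ContDiffOn ℝ 1 (fun p : ℝ × Coord d => u p.1 p.2 i j) (Iic 0 ×ˢ V)
  init : ∀ z ∈ V, u 0 z = h z
  evol : ∀ τ ≤ 0, ∀ z ∈ V, ∀ i j,
    HasDerivWithinAt (fun r => u r z i j) (N (u τ) z i j) (Iic 0) τ

end Connection

end OrdExp

/-! ### Parametric integrals over `[0, 1]` -/

section ParametricIntegral

set_option maxSynthPendingDepth 3

variable {E F : Type*} [NormedAddCommGroup E] [NormedAddCommGroup F]

/-! Fix `y` and let `φ` be the exponential map at `y`. In these normal coordinates `σ(φ(v), y) =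
g_y(v, v) / 2`, and the Gauss lemma (`IsNormalChart.gauss`) turns this into the statement that the
gradient `σ^ρ` at `φ(v)` is `Dφ(v)v` (`IsNormalChart.syngeLeft_eq`). So `σ^ρ∂_ρ` is the push-forward
of the Euler field, and `N_r` becomes `h ↦ Dh(v)v + α(v)(v) h(v)`, where `α` is the pulled-back
connection. The evolution it generates only rescales rays and transports along them.

Let `ψ` be parallel transport from the centre along rays, that is `Dψ(v)v = -α(v)(v) ψ(v)` and `ψ(0)
= 1`, and let `ξ` be its inverse (`exists_ray_transport`). The evolution is then explicit:
`(e^{τN_r} 1)(φ(v)) = ψ(v) ξ(e^τ v)` (`isOperatorExp_of_transport`). It is the only `C^1` solution,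
because every solution is determined along characteristics (`IsOperatorExp.eq_of_transport`). For `τ
= ln(1-t)` the factor `e^τ` is `1-t`, so `ξ(e^τ v) → ξ(0) = 1` and the limit is `ψ(v)`. The Picard
series of the radial equation, which constructs `ψ` and shows that it is `C^1` also at the centre
(`exists_radial_solution`), agrees term by term with the series of `Φ` (`algEquiv_iterInt`).

For `N_l`, symmetry of `σ` and transposition give an operator of the first kind, based at `x`, with
the dual connection `-Aᵀ`. Its limit at `y` is dual transport along the reversed geodesic. Transport
by a connection and by its dual preserves the natural pairing, so the transpose of this limit is
again `Φ` (`IsNormalChart.transport_reverse`). -/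

theorem ContinuousOn.uncurry_left_Icc {S : Set E} {g : E → ℝ → F}
    (hg : ContinuousOn (Function.uncurry g) (S ×ˢ Icc 0 1)) {v : E} (hv : v ∈ S) :
    ContinuousOn (g v) (Icc 0 1) :=
  hg.comp (f := fun r => (v, r)) (by fun_prop) fun _ hr => ⟨hv, hr⟩

theorem aestronglyMeasurable_uIoc_of_continuousOn_Icc {g : ℝ → F}
    (hg : ContinuousOn g (Icc 0 1)) :
    AEStronglyMeasurable g (volume.restrict (uIoc (0 : ℝ) 1)) := by
  rw [uIoc_of_le zero_le_one]
  exact (hg.mono Ioc_subset_Icc_self).aestronglyMeasurable measurableSet_Ioc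

variable [ProperSpace E]

/-- Closed balls are compact in a proper space, so continuity on a ball times `[0, 1]` yields a
constant. It serves as the dominating function for integrals depending on a parameter. -/
theorem exists_bound_nhds_of_continuousOn_prod_Icc {S : Set E} (hS : IsOpen S) {g : E → ℝ → F}
    (hg : ContinuousOn (Function.uncurry g) (S ×ˢ Icc 0 1)) {v : E} (hv : v ∈ S) :
    ∃ N ∈ 𝓝 v, N ⊆ S ∧ ∃ C, ∀ w ∈ N, ∀ r ∈ Icc (0 : ℝ) 1, ‖g w r‖ ≤ C := by
  obtain ⟨ε, hε, hb⟩ := Metric.nhds_basis_closedBall.mem_iff.1 (hS.mem_nhds hv)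
  obtain ⟨C, hC⟩ := ((isCompact_closedBall v ε).prod
    (isCompact_Icc (a := (0 : ℝ)) (b := 1))).exists_bound_of_continuousOn
      (hg.mono (prod_mono_left hb))
  exact ⟨_, Metric.closedBall_mem_nhds v hε, hb, C, fun w hw r hr => hC (w, r) ⟨hw, hr⟩⟩

variable [NormedSpace ℝ F]

theorem continuousOn_integral_of_continuousOn_prod_Icc {S : Set E} (hS : IsOpen S) {g : E → ℝ → F}
    (hg : ContinuousOn (Function.uncurry g) (S ×ˢ Icc 0 1)) :
    ContinuousOn (fun v => ∫ r in (0 : ℝ)..1, g v r) S := by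
  intro v hv
  obtain ⟨N, hN, hNS, C, hC⟩ := exists_bound_nhds_of_continuousOn_prod_Icc hS hg hv
  refine (intervalIntegral.continuousAt_of_dominated_interval (bound := fun _ => C) ?_ ?_
    intervalIntegrable_const ?_).continuousWithinAt
  · filter_upwards [hN] with w hw
    exact aestronglyMeasurable_uIoc_of_continuousOn_Icc (hg.uncurry_left_Icc (hNS hw))
  · filter_upwards [hN] with w hw
    refine ae_of_all _ fun r hr => hC w hw r ?_
    rw [uIoc_of_le zero_le_one] at hr
    exact Ioc_subset_Icc_self hr
  · refine ae_of_all _ fun r hr => ?_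
    rw [uIoc_of_le zero_le_one] at hr
    exact (hg.comp (f := fun w : E => (w, r)) (by fun_prop)
      fun _ hw => ⟨hw, Ioc_subset_Icc_self hr⟩).continuousAt (hS.mem_nhds hv)

variable [NormedSpace ℝ E]

theorem hasFDerivAt_integral_of_continuousOn_prod_Icc {S : Set E} (hS : IsOpen S)
    {g : E → ℝ → F} {g' : E → ℝ → E →L[ℝ] F}
    (hg : ContinuousOn (Function.uncurry g) (S ×ˢ Icc 0 1))
    (hg' : ContinuousOn (Function.uncurry g') (S ×ˢ Icc 0 1))
    (hd : ∀ v ∈ S, ∀ r ∈ Icc (0 : ℝ) 1, HasFDerivAt (fun w => g w r) (g' v r) v)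
    {v : E} (hv : v ∈ S) :
    HasFDerivAt (fun w => ∫ r in (0 : ℝ)..1, g w r) (∫ r in (0 : ℝ)..1, g' v r) v := by
  obtain ⟨N, hN, hNS, C, hC⟩ := exists_bound_nhds_of_continuousOn_prod_Icc hS hg' hv
  have hI : ∀ r, r ∈ uIoc (0 : ℝ) 1 → r ∈ Icc (0 : ℝ) 1 := fun r hr => by
    rw [uIoc_of_le zero_le_one] at hr
    exact Ioc_subset_Icc_self hr
  refine intervalIntegral.hasFDerivAt_integral_of_dominated_of_fderiv_le (bound := fun _ => C)
    hN ?_ ?_ ?_ ?_ intervalIntegrable_const ?_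
  · filter_upwards [hN] with w hw
    exact aestronglyMeasurable_uIoc_of_continuousOn_Icc (hg.uncurry_left_Icc (hNS hw))
  · refine ContinuousOn.intervalIntegrable ?_
    rw [uIcc_of_le zero_le_one]
    exact hg.uncurry_left_Icc hv
  · exact aestronglyMeasurable_uIoc_of_continuousOn_Icc (hg'.uncurry_left_Icc hv)
  · exact ae_of_all _ fun r hr w hw => hC w hw r (hI r hr)
  · exact ae_of_all _ fun r hr w hw => hd w (hNS hw) r (hI r hr)

end ParametricIntegral

/-! ### Linear differential equations along rays -/

section RadialODE

set_option maxSynthPendingDepth 3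

variable {E F : Type*} [NormedAddCommGroup E] [NormedSpace ℝ E]
  [NormedAddCommGroup F] [NormedSpace ℝ F]

/-- The Picard terms of the radial equation `Dψ(v) v = a(v)(v) ψ(v)`, `ψ(0) = w₀`. -/
noncomputable def radialTerm (a : E → E →L[ℝ] F →L[ℝ] F) (w₀ : F) : ℕ → E → F
  | 0, _ => w₀
  | k + 1, v => ∫ r in (0 : ℝ)..1, a (r • v) v (radialTerm a w₀ k (r • v))

/-- The derivative in `v` of the integrand `a(rv)(v) f(rv)`. -/
noncomputable def radialIntegrandDeriv (a : E → E →L[ℝ] F →L[ℝ] F)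
    (a' : E → E →L[ℝ] E →L[ℝ] F →L[ℝ] F) (f : E → F) (f' : E → E →L[ℝ] F) (v : E) (r : ℝ) :
    E →L[ℝ] F :=
  (a (r • v) v).comp (r • f' (r • v)) + (a (r • v) + r • (a' (r • v)).flip v).flip (f (r • v))

/-- The derivatives of the Picard terms. -/
noncomputable def radialTermDeriv (a : E → E →L[ℝ] F →L[ℝ] F)
    (a' : E → E →L[ℝ] E →L[ℝ] F →L[ℝ] F) (w₀ : F) : ℕ → E → E →L[ℝ] F
  | 0, _ => 0
  | k + 1, v => ∫ r in (0 : ℝ)..1,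
      radialIntegrandDeriv a a' (radialTerm a w₀ k) (radialTermDeriv a a' w₀ k) v r

variable {S : Set E} {a : E → E →L[ℝ] F →L[ℝ] F} {a' : E → E →L[ℝ] E →L[ℝ] F →L[ℝ] F}
  {f : E → F} {f' : E → E →L[ℝ] F} {w₀ : F}

theorem StarConvex.mapsTo_smul_Icc (hst : StarConvex ℝ 0 S) :
    MapsTo (fun p : E × ℝ => p.2 • p.1) (S ×ˢ Icc 0 1) S :=
  fun p hp => by simpa using hst.smul_mem hp.1 hp.2.1 hp.2.2

theorem continuousOn_radialIntegrand (hst : StarConvex ℝ 0 S) (ha : ContinuousOn a S)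
    (hf : ContinuousOn f S) :
    ContinuousOn (Function.uncurry fun v (r : ℝ) => a (r • v) v (f (r • v))) (S ×ˢ Icc 0 1) := by
  have hm := hst.mapsTo_smul_Icc
  have hc : ContinuousOn (fun p : E × ℝ => p.2 • p.1) (S ×ˢ Icc 0 1) := by fun_prop
  exact ((ha.comp hc hm).clm_apply continuousOn_fst).clm_apply (hf.comp hc hm)

theorem continuousOn_radialIntegrandDeriv (hst : StarConvex ℝ 0 S) (ha : ContinuousOn a S)
    (ha' : ContinuousOn a' S) (hf : ContinuousOn f S) (hf' : ContinuousOn f' S) :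
    ContinuousOn (Function.uncurry (radialIntegrandDeriv a a' f f')) (S ×ˢ Icc 0 1) := by
  have hm := hst.mapsTo_smul_Icc
  have hc : ContinuousOn (fun p : E × ℝ => p.2 • p.1) (S ×ˢ Icc 0 1) := by fun_prop
  have h1 := ha.comp hc hm
  have h2 := ha'.comp hc hm
  have h3 := hf.comp hc hm
  have h4 := hf'.comp hc hm
  refine ((h1.clm_apply continuousOn_fst).clm_comp (continuousOn_snd.smul h4)).add ?_
  have h5 : ContinuousOn (fun p : E × ℝ => (a' (p.2 • p.1)).flip p.1) (S ×ˢ Icc 0 1) :=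
    ((ContinuousLinearMap.flipₗᵢ ℝ E E (F →L[ℝ] F)).continuous.comp_continuousOn h2).clm_apply
      continuousOn_fst
  exact ((ContinuousLinearMap.flipₗᵢ ℝ E F F).continuous.comp_continuousOn
    (h1.add (continuousOn_snd.smul h5))).clm_apply h3

theorem hasFDerivAt_radialIntegrand (hst : StarConvex ℝ 0 S)
    (hda : ∀ v ∈ S, HasFDerivAt a (a' v) v) (hdf : ∀ v ∈ S, HasFDerivAt f (f' v) v)
    {v : E} (hv : v ∈ S) {r : ℝ} (hr : r ∈ Icc (0 : ℝ) 1) :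
    HasFDerivAt (fun w => a (r • w) w (f (r • w))) (radialIntegrandDeriv a a' f f' v r) v := by
  have hm : r • v ∈ S := hst.mapsTo_smul_Icc (x := (v, r)) ⟨hv, hr⟩
  have hs : HasFDerivAt (fun w : E => r • w) (r • ContinuousLinearMap.id ℝ E) v :=
    (hasFDerivAt_id v).const_smul r
  have h1 := (hda _ hm).comp v hs
  have h2 := (hdf _ hm).comp v hs
  refine ((h1.clm_apply (hasFDerivAt_id v)).clm_apply h2).congr_fderiv ?_
  ext w
  simp [radialIntegrandDeriv]

/-- The product rule gives two contributions: the derivative falls on `f`, with an extra factor `r`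
from rescaling, or on the coefficient and its direction argument. -/
theorem norm_radialIntegrandDeriv_le (v : E) (r : ℝ) (hr : 0 ≤ r) {B c c' : ℝ}
    (hB : ‖a (r • v)‖ ≤ B) (hB' : ‖a (r • v)‖ + ‖a' (r • v)‖ * ‖r • v‖ ≤ B)
    (hc : ‖f (r • v)‖ ≤ c) (hc' : ‖f' (r • v)‖ ≤ c') :
    ‖radialIntegrandDeriv a a' f f' v r‖ ≤ B * ‖v‖ * (r * c') + B * c := by
  have hB0 : 0 ≤ B := (norm_nonneg _).trans hB
  refine (norm_add_le _ _).trans (add_le_add ?_ ?_)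
  · refine (ContinuousLinearMap.opNorm_comp_le _ _).trans ?_
    rw [norm_smul, Real.norm_of_nonneg hr]
    gcongr
    exact (ContinuousLinearMap.le_opNorm _ _).trans (by gcongr)
  · refine (ContinuousLinearMap.le_opNorm _ _).trans ?_
    rw [ContinuousLinearMap.opNorm_flip]
    gcongr
    refine ((norm_add_le _ _).trans (add_le_add_right ?_ _)).trans hB'
    rw [norm_smul, norm_smul]
    calc ‖r‖ * ‖(a' (r • v)).flip v‖ ≤ ‖r‖ * (‖(a' (r • v)).flip‖ * ‖v‖) := by
          gcongr; exact ContinuousLinearMap.le_opNorm _ _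
      _ = _ := by rw [ContinuousLinearMap.opNorm_flip]; ring

/-- Rescaling the integration variable moves the parameter into the upper limit. In this form the
fundamental theorem of calculus applies, and the terms can be compared with iterated integrals. -/
theorem radialTerm_smul (k : ℕ) (v : E) {t : ℝ} :
    radialTerm a w₀ (k + 1) (t • v) = ∫ r in (0 : ℝ)..t, a (r • v) v (radialTerm a w₀ k (r • v)) := by
  have h := intervalIntegral.smul_integral_comp_mul_right (a := 0) (b := 1)
    (fun r => a (r • v) v (radialTerm a w₀ k (r • v))) t
  rw [zero_mul, one_mul] at h
  rw [← h, ← intervalIntegral.integral_smul]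
  simp [radialTerm, smul_smul]

theorem norm_integral_pow_bound {g : ℝ → F} {c : ℝ} (k : ℕ)
    (h : ∀ r ∈ Ioc (0 : ℝ) 1, ‖g r‖ ≤ c * r ^ k) :
    ‖∫ r in (0 : ℝ)..1, g r‖ ≤ c / (k + 1) := by
  refine (intervalIntegral.norm_integral_le_of_norm_le zero_le_one (g := fun r => c * r ^ k)
    (ae_of_all _ h) ?_).trans_eq ?_
  · exact (by fun_prop : Continuous fun r : ℝ => c * r ^ k).intervalIntegrable _ _
  · simp [div_eq_mul_inv]

/-- At `r • v` the inductive bound carries a factor `r ^ k`; its integral supplies the `1 / (k + 1)`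
that builds up the factorial. Star-shapedness of `Q` keeps the ray inside the region where `B` is a
bound. -/
theorem norm_radialTerm_le {Q : Set E} (hQ : StarConvex ℝ 0 Q) {B : ℝ}
    (hB : ∀ v ∈ Q, ‖a v‖ ≤ B) (k : ℕ) :
    ∀ v ∈ Q, ‖radialTerm a w₀ k v‖ ≤ ‖w₀‖ * (B * ‖v‖) ^ k / k.factorial := by
  induction k with
  | zero => intro v _; simp [radialTerm]
  | succ k ih =>
    intro v hv
    have hB0 : 0 ≤ B := (norm_nonneg _).trans (hB v hv)
    refine (norm_integral_pow_bound (c := B * ‖v‖ * (‖w₀‖ * (B * ‖v‖) ^ k / k.factorial)) k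
      fun r hr => ?_).trans_eq ?_
    · have hm := hQ.mapsTo_smul_Icc (x := (v, r)) ⟨hv, Ioc_subset_Icc_self hr⟩
      calc _ ≤ ‖a (r • v)‖ * ‖v‖ * ‖radialTerm a w₀ k (r • v)‖ :=
            (a (r • v)).le_opNorm₂ _ _
        _ ≤ B * ‖v‖ * (‖w₀‖ * (B * ‖r • v‖) ^ k / k.factorial) := by
            gcongr
            exacts [hB _ hm, ih _ hm]
        _ = _ := by
            rw [norm_smul, Real.norm_of_nonneg hr.1.le]; ring
    · rw [Nat.factorial_succ]; push_cast; field_simp; ring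

/-- The index starts at `k + 1` because the zeroth term is constant. The factor `2 ^ k` leaves room
for both contributions of the product rule while keeping the bounds summable. -/
theorem norm_radialTermDeriv_le {Q : Set E} (hQ : StarConvex ℝ 0 Q) {B : ℝ}
    (hB : ∀ v ∈ Q, ‖a v‖ + ‖a' v‖ * ‖v‖ ≤ B) (k : ℕ) :
    ∀ v ∈ Q, ‖radialTermDeriv a a' w₀ (k + 1) v‖ ≤
      ‖w₀‖ * B * (2 * B * ‖v‖) ^ k / k.factorial := by
  have hB1 : ∀ v ∈ Q, ‖a v‖ ≤ B := fun v hv => le_trans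
    (le_add_of_nonneg_right (by positivity)) (hB v hv)
  induction k with
  | zero =>
    intro v hv
    refine (norm_integral_pow_bound (c := B * ‖w₀‖) 0 fun r hr => ?_).trans_eq (by simp [mul_comm])
    have hm := hQ.mapsTo_smul_Icc (x := (v, r)) ⟨hv, Ioc_subset_Icc_self hr⟩
    refine (norm_radialIntegrandDeriv_le v r hr.1.le (hB1 _ hm) (hB _ hm)
      (c := ‖w₀‖) (c' := 0) le_rfl (by simp [radialTermDeriv])).trans_eq (by simp)
  | succ k ih =>
    intro v hv
    have hB0 : 0 ≤ B := (norm_nonneg _).trans (hB1 v hv)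
    refine (norm_integral_pow_bound (c := B * ‖v‖ * (‖w₀‖ * B * (2 * B * ‖v‖) ^ k / k.factorial) +
      B * (‖w₀‖ * (B * ‖v‖) ^ (k + 1) / (k + 1).factorial)) (k + 1) fun r hr => ?_).trans ?_
    · have hm := hQ.mapsTo_smul_Icc (x := (v, r)) ⟨hv, Ioc_subset_Icc_self hr⟩
      refine (norm_radialIntegrandDeriv_le v r hr.1.le (hB1 _ hm) (hB _ hm)
        (norm_radialTerm_le hQ hB1 (k + 1) _ hm) (ih _ hm)).trans_eq ?_
      rw [norm_smul, Real.norm_of_nonneg hr.1.le]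
      ring
    · rw [Nat.factorial_succ]; push_cast
      have h2 : (1 : ℝ) ≤ 2 ^ k := one_le_pow₀ one_le_two
      -- The claimed bound minus the estimate. Its sign is that of `2^(k+1) (k+2) - 2^k (k+1) - 1 =
      -- 2^k (k+3) - 1`.
      have e : ‖w₀‖ * B * (2 * B * ‖v‖) ^ (k + 1) / ((k + 1) * k.factorial) -
          (B * ‖v‖ * (‖w₀‖ * B * (2 * B * ‖v‖) ^ k / k.factorial) +
            B * (‖w₀‖ * (B * ‖v‖) ^ (k + 1) / ((k + 1) * k.factorial))) / (k + 1 + 1) =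
          ‖w₀‖ * B * (B * ‖v‖) ^ (k + 1) * (2 ^ k * (k + 3) - 1) /
            ((k + 1) * (k + 2) * k.factorial) := by
        field_simp
        ring
      rw [← sub_nonneg, e]
      have : (0 : ℝ) ≤ 2 ^ k * (k + 3) - 1 := by nlinarith [(Nat.cast_nonneg k : (0 : ℝ) ≤ k)]
      positivity

variable [ProperSpace E]

theorem radialTerm_spec (hS : IsOpen S) (hst : StarConvex ℝ 0 S)
    (hda : ∀ v ∈ S, HasFDerivAt a (a' v) v) (ha' : ContinuousOn a' S) (k : ℕ) :
    (∀ v ∈ S, HasFDerivAt (radialTerm a w₀ k) (radialTermDeriv a a' w₀ k v) v) ∧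
      ContinuousOn (radialTermDeriv a a' w₀ k) S := by
  have ha : ContinuousOn a S := fun v hv => (hda v hv).continuousAt.continuousWithinAt
  induction k with
  | zero => exact ⟨fun v _ => hasFDerivAt_const w₀ v, continuousOn_const⟩
  | succ k ih =>
    have hf : ContinuousOn (radialTerm a w₀ k) S :=
      fun v hv => (ih.1 v hv).continuousAt.continuousWithinAt
    have hc := continuousOn_radialIntegrandDeriv hst ha ha' hf ih.2
    exact ⟨fun v hv => hasFDerivAt_integral_of_continuousOn_prod_Icc hS
      (continuousOn_radialIntegrand hst ha hf) hc
      (fun w hw r hr => hasFDerivAt_radialIntegrand hst hda ih.1 hw hr) hv,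
      continuousOn_integral_of_continuousOn_prod_Icc hS hc⟩

/-- `Q` is the union of the segments from `0` to a small closed ball around `v`. One constant on `Q`
then bounds the coefficients along all rays ending near `v`. -/
theorem StarConvex.exists_ball_subset_compact (hS : IsOpen S) (hst : StarConvex ℝ 0 S) {v : E}
    (hv : v ∈ S) : ∃ ε > 0, ∃ Q ⊆ S, IsCompact Q ∧ StarConvex ℝ 0 Q ∧ Metric.ball v ε ⊆ Q := by
  obtain ⟨ε, hε, hb⟩ := Metric.nhds_basis_closedBall.mem_iff.1 (hS.mem_nhds hv)
  refine ⟨ε, hε, (fun p : E × ℝ => p.2 • p.1) '' (Metric.closedBall v ε ×ˢ Icc 0 1), ?_, ?_, ?_, ?_⟩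
  · exact (hst.mapsTo_smul_Icc.mono_left (prod_mono_left hb)).image_subset
  · exact ((isCompact_closedBall v ε).prod isCompact_Icc).image (by fun_prop)
  · rw [starConvex_zero_iff]
    rintro _ ⟨⟨w, r⟩, ⟨hw, hr⟩, rfl⟩ t ht0 ht1
    exact ⟨(w, t * r), ⟨hw, mul_nonneg ht0 hr.1, mul_le_one₀ ht1 hr.1 hr.2⟩, by simp [smul_smul]⟩
  · exact fun w hw => ⟨(w, 1), ⟨Metric.ball_subset_closedBall hw, by simp⟩, by simp⟩

/-- The radial equation `Dψ(v) v = a(v)(v) ψ(v)` with `ψ(0) = w₀` has a `C^1` solution on a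
star-shaped open set, given by the Picard series. -/
theorem exists_radial_solution [CompleteSpace F] (hS : IsOpen S) (hst : StarConvex ℝ 0 S)
    (ha : ContDiffOn ℝ 1 a S) (w₀ : F) :
    ∃ ψ : E → F, ContDiffOn ℝ 1 ψ S ∧ ψ 0 = w₀ ∧
      (∀ v ∈ S, fderiv ℝ ψ v v = a v v (ψ v)) ∧
      ∀ v ∈ S, HasSum (fun k => radialTerm a w₀ k v) (ψ v) := by
  have hda : ∀ v ∈ S, HasFDerivAt a (fderiv ℝ a v) v := fun v hv =>
    ((ha.differentiableOn one_ne_zero).differentiableAt (hS.mem_nhds hv)).hasFDerivAt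
  have hca : ContinuousOn a S := ha.continuousOn
  have hca' : ContinuousOn (fderiv ℝ a) S := ha.continuousOn_fderiv_of_isOpen hS le_rfl
  have hspec := fun k => radialTerm_spec (w₀ := w₀) hS hst hda hca' k
  set f := radialTerm a w₀ with hf
  set f' := radialTermDeriv a (fderiv ℝ a) w₀ with hf'
  have key : ∀ v ∈ S, ∃ ε > 0, Metric.ball v ε ⊆ S ∧ ∃ u : ℕ → ℝ, Summable u ∧
      (∀ k, ∀ w ∈ Metric.ball v ε, ‖f' k w‖ ≤ u k) ∧ ∀ w ∈ Metric.ball v ε,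
        Summable fun k => f k w := by
    intro v hv
    obtain ⟨ε, hε, Q, hQS, hQc, hQst, hbQ⟩ := hst.exists_ball_subset_compact hS hv
    obtain ⟨B, hB⟩ := hQc.exists_bound_of_continuousOn (f := fun v => ‖a v‖ + ‖fderiv ℝ a v‖ * ‖v‖)
      ((hca.mono hQS).norm.add ((hca'.mono hQS).norm.mul continuousOn_id.norm))
    obtain ⟨R, hR⟩ := hQc.exists_bound_of_continuousOn (f := fun v : E => v) continuousOn_id
    have hB1 : ∀ v ∈ Q, ‖a v‖ + ‖fderiv ℝ a v‖ * ‖v‖ ≤ B :=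
      fun v hv => (le_abs_self _).trans (hB v hv)
    have hB2 : ∀ v ∈ Q, ‖a v‖ ≤ B := fun v hv =>
      (le_add_of_nonneg_right (by positivity)).trans (hB1 v hv)
    have hvQ : v ∈ Q := hbQ (Metric.mem_ball_self hε)
    have hB0 : 0 ≤ B := (norm_nonneg _).trans (hB2 v hvQ)
    -- The majorant is `0` at index `0`, where the term is constant; the later ones form a shifted
    -- exponential series.
    refine ⟨ε, hε, hbQ.trans hQS,
      fun k => Nat.casesOn k 0 fun k => ‖w₀‖ * B * ((2 * B * R) ^ k / k.factorial), ?_, ?_, ?_⟩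
    · rw [← summable_nat_add_iff 1]
      exact (Real.summable_pow_div_factorial _).mul_left _
    · rintro (_ | k) w hw
      · simp [hf', radialTermDeriv]
      · refine (norm_radialTermDeriv_le hQst hB1 k w (hbQ hw)).trans ?_
        rw [mul_div_assoc]
        have := hR w (hbQ hw)
        dsimp only
        gcongr
    · intro w hw
      refine Summable.of_norm_bounded (g := fun k => ‖w₀‖ * ((B * ‖w‖) ^ k / k.factorial))
        ((Real.summable_pow_div_factorial _).mul_left _) fun k => ?_
      rw [← mul_div_assoc]
      exact norm_radialTerm_le hQst hB2 k w (hbQ hw)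
  have hder : ∀ v ∈ S, HasFDerivAt (fun w => ∑' k, f k w) (∑' k, f' k v) v := by
    intro v hv
    obtain ⟨ε, hε, hb, u, hu, hbd, hsum⟩ := key v hv
    exact hasFDerivAt_tsum_of_isPreconnected hu Metric.isOpen_ball
      (convex_ball v ε).isPreconnected (fun k w hw => (hspec k).1 w (hb hw)) hbd
      (Metric.mem_ball_self hε) (hsum v (Metric.mem_ball_self hε)) (Metric.mem_ball_self hε)
  have hcont : ContinuousOn (fun v => ∑' k, f' k v) S := by
    intro v hv
    obtain ⟨ε, hε, hb, u, hu, hbd, -⟩ := key v hv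
    exact ((continuousOn_tsum (fun k => (hspec k).2.mono hb) hu hbd).continuousAt
      (Metric.ball_mem_nhds v hε)).continuousWithinAt
  refine ⟨fun v => ∑' k, f k v, ?_, ?_, ?_, ?_⟩
  · refine (contDiffOn_succ_iff_fderiv_of_isOpen (n := 0) hS).2
      ⟨fun v hv => (hder v hv).differentiableAt.differentiableWithinAt, by simp, ?_⟩
    rw [contDiffOn_zero]
    exact hcont.congr fun v hv => (hder v hv).fderiv
  · dsimp only
    rw [tsum_eq_single 0]
    · rfl
    · rintro (_ | k) hk
      · exact absurd rfl hk
      · simp [hf, radialTerm]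
  · intro v hv
    rw [(hder v hv).fderiv]
    obtain ⟨ε, hε, hb, u, hu, hbd, hsum⟩ := key v hv
    have hmem := Metric.mem_ball_self (x := v) hε
    have hs' : Summable fun k => f' k v := Summable.of_norm_bounded hu fun k => hbd k v hmem
    have h1 : (∑' k, f' k v) v = ∑' k, f' k v v :=
      (ContinuousLinearMap.apply ℝ F v).map_tsum hs'
    have h2 : a v v (∑' k, f k v) = ∑' k, a v v (f k v) := (a v v).map_tsum (hsum v hmem)
    have h3 : Summable fun k => f' k v v := (ContinuousLinearMap.apply ℝ F v).summable hs'
    rw [h1, h2, h3.tsum_eq_zero_add]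
    have h0 : f' 0 v v = 0 := by simp [hf', radialTermDeriv]
    rw [h0, zero_add]
    congr 1
    ext k
    have hfc : ContinuousOn (f k) S := fun w hw =>
      ((hspec k).1 w hw).continuousAt.continuousWithinAt
    have hic := (continuousOn_radialIntegrand hst hca hfc).uncurry_left_Icc hv
    -- The map `t ↦ f (k + 1) (t • v)` is differentiated at `t = 1` in two ways, by the chain rule
    -- and by the fundamental theorem of calculus. The derivative is one-sided because the integrand
    -- is controlled only on `[0, 1]`.
    have hd1 : HasDerivWithinAt (fun t : ℝ => f (k + 1) (t • v)) (f' (k + 1) v v) (Icc 0 1) 1 := by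
      have h := ((hspec (k + 1)).1 v hv)
      have hl : HasDerivAt (fun t : ℝ => t • v) v 1 := by
        simpa using (hasDerivAt_id (1 : ℝ)).smul_const v
      have h' : HasFDerivAt (f (k + 1)) (f' (k + 1) v) ((1 : ℝ) • v) := by rwa [one_smul]
      exact (h'.comp_hasDerivAt 1 hl).hasDerivWithinAt
    have hd2 : HasDerivWithinAt (fun t : ℝ => f (k + 1) (t • v)) (a v v (f k v)) (Icc 0 1) 1 := by
      have hii : IntervalIntegrable (fun r : ℝ => a (r • v) v (f k (r • v))) volume 0 1 := by
        apply ContinuousOn.intervalIntegrable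
        rwa [uIcc_of_le zero_le_one]
      have h1m : (1 : ℝ) ∈ Icc (0 : ℝ) 1 := by simp
      have : Fact ((1 : ℝ) ∈ Icc (0 : ℝ) 1) := ⟨h1m⟩
      have := intervalIntegral.integral_hasDerivWithinAt_right (s := Icc 0 1) (t := Icc 0 1) hii
        ⟨Icc 0 1, self_mem_nhdsWithin, hic.aestronglyMeasurable measurableSet_Icc⟩ (hic 1 h1m)
      simp only [one_smul] at this
      exact this.congr (fun t _ => radialTerm_smul k v) (radialTerm_smul k v)
    exact (uniqueDiffOn_Icc zero_lt_one 1 (by simp)).eq_deriv _ hd1 hd2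
  · intro v hv
    obtain ⟨ε, hε, hb, u, hu, hbd, hsum⟩ := key v hv
    exact (hsum v (Metric.mem_ball_self hε)).hasSum

end RadialODE

/-! ### Parallel transport along rays and its inverse. -/

section Transport

set_option maxSynthPendingDepth 3

variable {E 𝓐 : Type*} [NormedAddCommGroup E] [NormedSpace ℝ E]
  [NormedRing 𝓐] [NormedAlgebra ℝ 𝓐]

/-- Left multiplication by `-α`. -/
noncomputable def negMulLeft (α : E → E →L[ℝ] 𝓐) (v : E) : E →L[ℝ] 𝓐 →L[ℝ] 𝓐 :=
  -(ContinuousLinearMap.mul ℝ 𝓐).comp (α v)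

/-- Right multiplication by `α`. -/
noncomputable def mulRight (α : E → E →L[ℝ] 𝓐) (v : E) : E →L[ℝ] 𝓐 →L[ℝ] 𝓐 :=
  (ContinuousLinearMap.mul ℝ 𝓐).flip.comp (α v)

@[simp]
theorem negMulLeft_apply (α : E → E →L[ℝ] 𝓐) (v w : E) (x : 𝓐) :
    negMulLeft α v w x = -(α v w * x) := rfl

@[simp]
theorem mulRight_apply (α : E → E →L[ℝ] 𝓐) (v w : E) (x : 𝓐) :
    mulRight α v w x = x * α v w := rfl

theorem ContDiffOn.negMulLeft {α : E → E →L[ℝ] 𝓐} {S : Set E} (hα : ContDiffOn ℝ 1 α S) :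
    ContDiffOn ℝ 1 (negMulLeft α) S :=
  (contDiffOn_const.clm_comp hα).neg

theorem ContDiffOn.mulRight {α : E → E →L[ℝ] 𝓐} {S : Set E} (hα : ContDiffOn ℝ 1 α S) :
    ContDiffOn ℝ 1 (mulRight α) S :=
  contDiffOn_const.clm_comp hα

theorem StarConvex.smul_mem_of_mem_Icc {S : Set E} (hst : StarConvex ℝ 0 S) {v : E} (hv : v ∈ S)
    {r : ℝ} (hr : r ∈ Icc (0 : ℝ) 1) : r • v ∈ S := by
  simpa using hst.smul_mem hv hr.1 hr.2

/-- The derivative of a function along a ray, in terms of its radial derivative. -/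
theorem hasDerivAt_ray {F : Type*} [NormedAddCommGroup F] [NormedSpace ℝ F] {f : E → F} {v : E}
    {r : ℝ} (hr : r ≠ 0) (hf : DifferentiableAt ℝ f (r • v)) :
    HasDerivAt (fun s : ℝ => f (s • v)) (r⁻¹ • fderiv ℝ f (r • v) (r • v)) r := by
  have hl : HasDerivAt (fun t : ℝ => t • v) v r := by
    simpa using (hasDerivAt_id r).smul_const v
  refine (hf.hasFDerivAt.comp_hasDerivAt r hl).congr_deriv ?_
  rw [map_smul, smul_smul, inv_mul_cancel₀ hr, one_smul]

/-- No derivative is required at the end points: the radial derivative determines the derivative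
along a ray only for `r ≠ 0`. Continuity covers the end points. -/
theorem eq_of_hasDerivAt_zero_Ioo {F : Type*} [NormedAddCommGroup F] [NormedSpace ℝ F]
    {f : ℝ → F} {a b : ℝ} (hab : a ≤ b) (hc : ContinuousOn f (Icc a b))
    (hd : ∀ r ∈ Ioo a b, HasDerivAt f 0 r) : f a = f b := by
  rcases hab.eq_or_lt with rfl | hab
  · rfl
  have hconst : ∀ ε ∈ Ioo a b, f b = f ε := fun ε hε =>
    constant_of_has_deriv_right_zero (hc.mono (Icc_subset_Icc_left hε.1.le))
      (fun r hr => (hd r ⟨hε.1.trans_le hr.1, hr.2⟩).hasDerivWithinAt) b ⟨hε.2.le, le_rfl⟩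
  have hlim : Tendsto f (𝓝[>] a) (𝓝 (f a)) := by
    refine (hc a (left_mem_Icc.2 hab.le)).tendsto.mono_left ?_
    rw [← nhdsWithin_Ioo_eq_nhdsGT hab]
    exact nhdsWithin_mono _ Ioo_subset_Icc_self
  refine tendsto_nhds_unique hlim (tendsto_const_nhds.congr' ?_)
  filter_upwards [Ioo_mem_nhdsGT hab] with r hr using hconst r hr

/-- Functions on a star-shaped set whose radial derivative vanishes are constant along rays. -/
theorem eq_zero_value_of_fderiv_ray {F : Type*} [NormedAddCommGroup F] [NormedSpace ℝ F]
    {f : E → F} {S : Set E} (hS : IsOpen S) (hst : StarConvex ℝ 0 S)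
    (hf : DifferentiableOn ℝ f S) (h0 : ∀ v ∈ S, fderiv ℝ f v v = 0) {v : E} (hv : v ∈ S) :
    f v = f 0 := by
  have hm : ∀ r ∈ Icc (0 : ℝ) 1, r • v ∈ S := fun r hr => hst.smul_mem_of_mem_Icc hv hr
  have hc : ContinuousOn (fun r : ℝ => f (r • v)) (Icc 0 1) :=
    hf.continuousOn.comp (by fun_prop) hm
  have h1 : ∀ r ∈ Ioo (0 : ℝ) 1, HasDerivAt (fun r : ℝ => f (r • v)) 0 r := by
    intro r hr
    have hrS := hm r (Ioo_subset_Icc_self hr)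
    have := hasDerivAt_ray hr.1.ne' (hf.differentiableAt (hS.mem_nhds hrS))
    rwa [h0 _ hrS, smul_zero] at this
  simpa using (eq_of_hasDerivAt_zero_Ioo zero_le_one hc h1).symm

/-- Parallel transport along rays `ψ` together with its inverse `ξ`. -/
theorem exists_ray_transport [ProperSpace E] [CompleteSpace 𝓐] [IsDedekindFiniteMonoid 𝓐]
    {S : Set E} (hS : IsOpen S) (hst : StarConvex ℝ 0 S) {α : E → E →L[ℝ] 𝓐}
    (hα : ContDiffOn ℝ 1 α S) :
    ∃ ψ ξ : E → 𝓐, ContDiffOn ℝ 1 ψ S ∧ ContDiffOn ℝ 1 ξ S ∧ ψ 0 = 1 ∧ ξ 0 = 1 ∧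
      (∀ v ∈ S, fderiv ℝ ψ v v = -(α v v * ψ v)) ∧ (∀ v ∈ S, fderiv ℝ ξ v v = ξ v * α v v) ∧
      (∀ v ∈ S, ψ v * ξ v = 1) ∧
      ∀ v ∈ S, HasSum (fun k => radialTerm (negMulLeft α) 1 k v) (ψ v) := by
  obtain ⟨ψ, hψ, hψ0, hψd, hψs⟩ := exists_radial_solution hS hst hα.negMulLeft (1 : 𝓐)
  obtain ⟨ξ, hξ, hξ0, hξd, -⟩ := exists_radial_solution hS hst hα.mulRight (1 : 𝓐)
  refine ⟨ψ, ξ, hψ, hξ, hψ0, hξ0, hψd, hξd, fun v hv => ?_, hψs⟩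
  -- The radial derivative of the product in the other order is `ξ α ψ - ξ α ψ = 0`, so `ξ ψ = 1` is
  -- what is proved; Dedekind finiteness then gives `ψ ξ = 1`.
  rw [mul_eq_one_comm]
  have := eq_zero_value_of_fderiv_ray (f := fun v => ξ v * ψ v) hS hst
    ((hξ.mul hψ).differentiableOn one_ne_zero) (fun w hw => ?_) hv
  · simpa [hψ0, hξ0] using this
  have h1 := ((hξ.differentiableOn one_ne_zero).differentiableAt (hS.mem_nhds hw)).hasFDerivAt
  have h2 := ((hψ.differentiableOn one_ne_zero).differentiableAt (hS.mem_nhds hw)).hasFDerivAt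
  rw [(h1.fun_mul' h2).fderiv]
  simp [hψd w hw, hξd w hw, mul_assoc]

end Transport

namespace OrdExp

/-! ### The evolution generated by a radial first-order operator. -/

section RadialOperator

set_option maxSynthPendingDepth 3

variable {d : ℕ} {ι : Type*} [Fintype ι] [DecidableEq ι]
  {𝓐 : Type*} [NormedRing 𝓐] [NormedAlgebra ℝ 𝓐]
  (κ : Matrix ι ι ℝ ≃ₐ[ℝ] 𝓐)

/-- Regularity of matrix functions is stated entrywise, while the radial equation lives in a normed
algebra. Expansion in matrix units passes from the first to the second. -/
theorem contDiffOn_algEquiv_comp {E : Type*} [NormedAddCommGroup E] [NormedSpace ℝ E]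
    {n : WithTop ℕ∞} {s : Set E} {h : E → Matrix ι ι ℝ}
    (hh : ∀ i j, ContDiffOn ℝ n (fun z => h z i j) s) : ContDiffOn ℝ n (fun z => κ (h z)) s := by
  have e : (fun z => κ (h z)) = fun z => ∑ i, ∑ j, h z i j • κ (Matrix.single i j 1) := by
    ext z
    conv_lhs => rw [Matrix.matrix_eq_sum_single (h z)]
    simp only [map_sum, ← map_smul, Matrix.smul_single, smul_eq_mul, mul_one]
  rw [e]
  exact ContDiffOn.sum fun i _ => ContDiffOn.sum fun j _ => (hh i j).smul contDiffOn_const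

theorem coord_eq_sum (x : Coord d) : x = ∑ ρ, x ρ • EuclideanSpace.single ρ (1 : ℝ) := by
  ext i
  simp [Pi.single_apply]

/-- The operator `X^ρ D_ρ` for a vector field `X`. -/
noncomputable def vectorOp (A : Fin d → Coord d → Matrix ι ι ℝ) (X : Fin d → Coord d → ℝ)
    (h : Coord d → Matrix ι ι ℝ) (z : Coord d) : Matrix ι ι ℝ :=
  ∑ ρ, X ρ z • covLeft A ρ h z

/-- The pull-back of the connection form `A` under `φ`. -/
noncomputable def pullConn (A : Fin d → Coord d → Matrix ι ι ℝ) (φ : Coord d → Coord d)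
    (v : Coord d) : Coord d →L[ℝ] 𝓐 :=
  ∑ μ, ((EuclideanSpace.proj μ : Coord d →L[ℝ] ℝ).comp (fderiv ℝ φ v)).smulRight (κ (A μ (φ v)))

variable {A : Fin d → Coord d → Matrix ι ι ℝ} {X : Fin d → Coord d → ℝ}

theorem pullConn_apply (φ : Coord d → Coord d) (v w : Coord d) :
    pullConn κ A φ v w = κ (∑ μ, fderiv ℝ φ v w μ • A μ (φ v)) := by
  simp [pullConn, map_sum]

theorem contDiffOn_pullConn {φ : OpenPartialHomeomorph (Coord d) (Coord d)}
    (hφ : ContDiffOn ℝ ∞ φ φ.source) (hA : ∀ μ i j, ContDiffOn ℝ ∞ (fun z => A μ z i j) φ.target) :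
    ContDiffOn ℝ 1 (pullConn κ A φ) φ.source := by
  have h1 : ContDiffOn ℝ 1 (fderiv ℝ φ) φ.source :=
    hφ.fderiv_of_isOpen φ.open_source (by norm_cast)
  refine ContDiffOn.sum fun μ _ => ?_
  have h2 : ContDiffOn ℝ 1 (fun v => κ (A μ (φ v))) φ.source :=
    (contDiffOn_algEquiv_comp κ fun i j => (hA μ i j).of_le (by norm_cast)).comp
      (hφ.of_le (by norm_cast)) φ.mapsTo
  exact (contDiffOn_const.clm_comp h1).smulRight h2

variable [FiniteDimensional ℝ 𝓐]

/-- Matrix entries as functionals on a normed algebra isomorphic to the matrix algebra. -/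
noncomputable def entryCLM (i j : ι) : 𝓐 →L[ℝ] ℝ :=
  LinearMap.toContinuousLinearMap (Matrix.entryLinearMap ℝ ℝ i j ∘ₗ κ.symm.toLinearMap)

theorem entryCLM_apply (i j : ι) (x : 𝓐) : entryCLM κ i j x = κ.symm x i j := rfl

@[simp]
theorem entryCLM_map (i j : ι) (x : Matrix ι ι ℝ) : entryCLM κ i j (κ x) = x i j := by
  simp [entryCLM_apply]

theorem continuous_symm_algEquiv : Continuous κ.symm :=
  continuous_pi fun i => continuous_pi fun j => (entryCLM κ i j).continuous

theorem algEquiv_covLeft {h : Coord d → Matrix ι ι ℝ} {z : Coord d}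
    (hh : DifferentiableAt ℝ (fun w => κ (h w)) z) (ρ : Fin d) :
    κ (covLeft A ρ h z) =
      fderiv ℝ (fun w => κ (h w)) z (EuclideanSpace.single ρ 1) + κ (A ρ z) * κ (h z) := by
  rw [covLeft, map_add, map_mul]
  congr 1
  apply κ.symm.injective
  rw [AlgEquiv.symm_apply_apply]
  ext i j
  have e : (fun w => h w i j) = fun w => entryCLM κ i j (κ (h w)) := by
    ext w; simp
  rw [← entryCLM_apply, Matrix.of_apply, pd, e]
  have := ((entryCLM κ i j).hasFDerivAt.comp z hh.hasFDerivAt).fderiv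
  rw [Function.comp_def] at this
  rw [this]
  rfl

/-- When `X` is the push-forward of the Euler field, the chain rule turns `X^ρ D_ρ` into the radial
derivative plus multiplication by the pulled-back connection. -/
theorem algEquiv_vectorOp {h : Coord d → Matrix ι ι ℝ} {φ : Coord d → Coord d} {v : Coord d}
    (hX : ∀ ρ, X ρ (φ v) = fderiv ℝ φ v v ρ) (hφ : DifferentiableAt ℝ φ v)
    (hh : DifferentiableAt ℝ (fun w => κ (h w)) (φ v)) :
    κ (vectorOp A X h (φ v)) =
      fderiv ℝ (fun w => κ (h (φ w))) v v + pullConn κ A φ v v * κ (h (φ v)) := by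
  have hc := (hh.hasFDerivAt.comp v hφ.hasFDerivAt).fderiv
  rw [Function.comp_def] at hc
  rw [hc, ContinuousLinearMap.comp_apply, pullConn_apply, vectorOp]
  conv_rhs => rw [coord_eq_sum (fderiv ℝ φ v v)]
  simp only [map_sum, map_smul, algEquiv_covLeft κ hh, Finset.sum_mul, smul_mul_assoc,
    ← Finset.sum_add_distrib, smul_add, hX]
  refine Finset.sum_congr rfl fun ρ _ => ?_
  rw [← coord_eq_sum]

/-- The radial derivative of the factor `ψ(v)` cancels the connection term. What remains, `ψ(v)
Dξ(e^τ v)(e^τ v)`, is also the `τ`-derivative of `ψ(v) ξ(e^τ v)`. -/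
theorem isOperatorExp_of_transport {φ : OpenPartialHomeomorph (Coord d) (Coord d)}
    (hst : StarConvex ℝ 0 φ.source) (hφ : ContDiffOn ℝ ∞ φ φ.source)
    (hφ' : ContDiffOn ℝ ∞ φ.symm φ.target)
    (hX : ∀ v ∈ φ.source, ∀ ρ, X ρ (φ v) = fderiv ℝ φ v v ρ) {ψ ξ : Coord d → 𝓐}
    (hψ : ContDiffOn ℝ 1 ψ φ.source) (hξ : ContDiffOn ℝ 1 ξ φ.source)
    (hψd : ∀ v ∈ φ.source, fderiv ℝ ψ v v = -(pullConn κ A φ v v * ψ v))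
    (hψξ : ∀ v ∈ φ.source, ψ v * ξ v = 1) :
    IsOperatorExp φ.target (vectorOp A X) (fun _ => 1)
      fun τ z => κ.symm (ψ (φ.symm z) * ξ (Real.exp τ • φ.symm z)) := by
  have hS := φ.open_source
  have hexp : ∀ τ ≤ 0, Real.exp τ ∈ Icc (0 : ℝ) 1 := fun τ hτ =>
    ⟨(Real.exp_pos τ).le, Real.exp_le_one_iff.2 hτ⟩
  have hφ1 : ContDiffOn ℝ 1 φ.symm φ.target := hφ'.of_le (by norm_cast)
  have hjoint : ContDiffOn ℝ 1 (fun p : ℝ × Coord d =>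
      ψ (φ.symm p.2) * ξ (Real.exp p.1 • φ.symm p.2)) (Iic 0 ×ˢ φ.target) := by
    have h2 : ContDiffOn ℝ 1 (fun p : ℝ × Coord d => φ.symm p.2) (Iic 0 ×ˢ φ.target) :=
      hφ1.comp contDiffOn_snd fun p hp => hp.2
    have h3 : ContDiffOn ℝ 1 (fun p : ℝ × Coord d => Real.exp p.1) (Iic 0 ×ˢ φ.target) :=
      (Real.contDiff_exp.comp contDiff_fst).contDiffOn
    exact (hψ.comp h2 fun p hp => φ.map_target hp.2).mul (hξ.comp (h3.smul h2) fun p hp =>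
      hst.smul_mem_of_mem_Icc (φ.map_target hp.2) (hexp _ hp.1))
  refine ⟨fun i j => (entryCLM κ i j).contDiff.comp_contDiffOn hjoint, fun z hz => ?_,
    fun τ hτ z hz i j => ?_⟩
  · simp [hψξ _ (φ.map_target hz)]
  obtain ⟨v, hv, rfl⟩ : ∃ v ∈ φ.source, φ v = z := ⟨φ.symm z, φ.map_target hz, φ.right_inv hz⟩
  have hvτ := hst.smul_mem_of_mem_Icc hv (hexp τ hτ)
  have hψv := ((hψ.differentiableOn one_ne_zero).differentiableAt (hS.mem_nhds hv)).hasFDerivAt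
  have hξv := ((hξ.differentiableOn one_ne_zero).differentiableAt (hS.mem_nhds hvτ)).hasFDerivAt
  have hN : κ (vectorOp A X (fun z => κ.symm (ψ (φ.symm z) * ξ (Real.exp τ • φ.symm z))) (φ v)) =
      ψ v * fderiv ℝ ξ (Real.exp τ • v) (Real.exp τ • v) := by
    rw [algEquiv_vectorOp κ (hX v hv)
      ((hφ.differentiableOn (by simp)).differentiableAt (hS.mem_nhds hv))]
    · have e : (fun w => κ (κ.symm (ψ (φ.symm (φ w)) * ξ (Real.exp τ • φ.symm (φ w))))) =ᶠ[𝓝 v]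
          fun w => ψ w * ξ (Real.exp τ • w) := by
        filter_upwards [hS.mem_nhds hv] with w hw
        rw [φ.left_inv hw, AlgEquiv.apply_symm_apply]
      have hs : HasFDerivAt (fun w : Coord d => Real.exp τ • w)
          (Real.exp τ • ContinuousLinearMap.id ℝ (Coord d)) v :=
        HasFDerivAt.fun_const_smul (hasFDerivAt_id v) _
      have hp := hψv.fun_mul' (hξv.comp v hs)
      simp only [Function.comp_def] at hp
      rw [e.fderiv_eq, hp.fderiv, φ.left_inv hv, AlgEquiv.apply_symm_apply]
      simp [hψd v hv, mul_assoc]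
    · have h : ContDiffOn ℝ 1 (fun z => ψ (φ.symm z) * ξ (Real.exp τ • φ.symm z)) φ.target :=
        hjoint.comp (contDiffOn_const.prodMk contDiffOn_id) fun z hz => ⟨hτ, hz⟩
      simp only [AlgEquiv.apply_symm_apply]
      exact (h.differentiableOn one_ne_zero).differentiableAt
        (φ.open_target.mem_nhds (φ.map_source hv))
  have hd : HasDerivAt (fun r => ψ v * ξ (Real.exp r • v))
      (ψ v * fderiv ℝ ξ (Real.exp τ • v) (Real.exp τ • v)) τ := by
    have h1 : HasDerivAt (fun r => Real.exp r • v) (Real.exp τ • v) τ :=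
      (Real.hasDerivAt_exp τ).smul_const v
    exact (hξv.comp_hasDerivAt τ h1).const_mul (ψ v)
  have := ((entryCLM κ i j).hasFDerivAt.comp_hasDerivAt τ hd).hasDerivWithinAt (s := Iic 0)
  rw [← hN, entryCLM_map] at this
  simp only [φ.left_inv hv]
  exact this

/-- Method of characteristics: along the curve `t ↦ (t, φ(e^(τ-t) v))` the change of any solution is
governed by the connection alone, and the factor `ξ` compensates it, so the product is constant. -/
theorem IsOperatorExp.eq_of_transport {φ : OpenPartialHomeomorph (Coord d) (Coord d)}
    (hst : StarConvex ℝ 0 φ.source) (hφ : ContDiffOn ℝ ∞ φ φ.source)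
    (hX : ∀ v ∈ φ.source, ∀ ρ, X ρ (φ v) = fderiv ℝ φ v v ρ) {ψ ξ : Coord d → 𝓐}
    (hξ : ContDiffOn ℝ 1 ξ φ.source)
    (hξd : ∀ v ∈ φ.source, fderiv ℝ ξ v v = ξ v * pullConn κ A φ v v)
    (hψξ : ∀ v ∈ φ.source, ψ v * ξ v = 1) {w : ℝ → Coord d → Matrix ι ι ℝ}
    (hw : IsOperatorExp φ.target (vectorOp A X) (fun _ => 1) w) {τ : ℝ} (hτ : τ ≤ 0)
    {v : Coord d} (hv : v ∈ φ.source) : κ (w τ (φ v)) = ψ v * ξ (Real.exp τ • v) := by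
  have hS := φ.open_source
  have hW : ContDiffOn ℝ 1 (fun p : ℝ × Coord d => κ (w p.1 p.2)) (Iic 0 ×ˢ φ.target) :=
    contDiffOn_algEquiv_comp κ hw.contDiffOn
  have hmem : ∀ t ∈ Icc τ 0, Real.exp (τ - t) • v ∈ φ.source := fun t ht =>
    hst.smul_mem_of_mem_Icc hv ⟨(Real.exp_pos _).le, Real.exp_le_one_iff.2 (by linarith [ht.1])⟩
  -- At `t = τ` the product is `ξ(v) w(τ, φ(v))`, at `t = 0` it is `ξ(e^τ v)` by the initial
  -- condition. Multiplication by `ψ(v)` on the left isolates `w`.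
  suffices h : ξ (Real.exp (τ - τ) • v) * κ (w τ (φ (Real.exp (τ - τ) • v))) =
      ξ (Real.exp (τ - 0) • v) * κ (w 0 (φ (Real.exp (τ - 0) • v))) by
    rw [hw.init _ (φ.map_source (hmem 0 ⟨hτ, le_rfl⟩))] at h
    simp only [sub_self, Real.exp_zero, one_smul, sub_zero, map_one, mul_one] at h
    rw [← h, ← mul_assoc, hψξ v hv, one_mul]
  refine eq_of_hasDerivAt_zero_Ioo
    (f := fun t => ξ (Real.exp (τ - t) • v) * κ (w t (φ (Real.exp (τ - t) • v)))) hτ ?_ ?_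
  · have h1 : ContinuousOn (fun t => Real.exp (τ - t) • v) (Icc τ 0) := by fun_prop
    refine (hξ.continuousOn.comp h1 hmem).mul ?_
    exact hW.continuousOn.comp (f := fun t => (t, φ (Real.exp (τ - t) • v)))
      (continuousOn_id.prodMk (hφ.continuousOn.comp h1 hmem))
      fun t ht => ⟨ht.2, φ.map_source (hmem t ht)⟩
  · intro t ht
    have hx := hmem t (Ioo_subset_Icc_self ht)
    set x := Real.exp (τ - t) • v with hxdef
    have hcurve : HasDerivAt (fun t => Real.exp (τ - t) • v) (-x) t := by
      have := (((hasDerivAt_id t).const_sub τ).exp).smul_const v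
      simpa [hxdef] using this
    have hφx := ((hφ.differentiableOn (by simp)).differentiableAt (hS.mem_nhds hx))
    have h1 := ((hξ.differentiableOn one_ne_zero).differentiableAt
      (hS.mem_nhds hx)).hasFDerivAt.comp_hasDerivAt t hcurve
    rw [map_neg, hξd x hx] at h1
    have hnhds : Iic (0 : ℝ) ×ˢ φ.target ∈ 𝓝 (t, φ x) :=
      prod_mem_nhds (Iic_mem_nhds ht.2) (φ.open_target.mem_nhds (φ.map_source hx))
    have hWd := ((hW.differentiableOn one_ne_zero).differentiableAt hnhds).hasFDerivAt
    set D := fderiv ℝ (fun p : ℝ × Coord d => κ (w p.1 p.2)) (t, φ x) with hD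
    have hγ : HasDerivAt (fun t => φ (Real.exp (τ - t) • v)) (fderiv ℝ φ x (-x)) t :=
      hφx.hasFDerivAt.comp_hasDerivAt t hcurve
    have h2 : HasDerivAt (fun t => κ (w t (φ (Real.exp (τ - t) • v))))
        (D (1, fderiv ℝ φ x (-x))) t :=
      hWd.comp_hasDerivAt (f := fun t => (t, φ (Real.exp (τ - t) • v))) t
        ((hasDerivAt_id t).prodMk hγ)
    have htime : D (1, 0) = κ (vectorOp A X (w t) (φ x)) := by
      have h3 : HasDerivAt (fun r => κ (w r (φ x))) (D (1, 0)) t :=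
        hWd.comp_hasDerivAt (f := fun r => (r, φ x)) t
          ((hasDerivAt_id t).prodMk (hasDerivAt_const t _))
      apply κ.symm.injective
      rw [AlgEquiv.symm_apply_apply]
      ext i j
      have h4 := (entryCLM κ i j).hasFDerivAt.comp_hasDerivAt t h3
      have h5 := (hw.evol t ht.2.le _ (φ.map_source hx) i j).hasDerivAt (Iic_mem_nhds ht.2)
      simp only [Function.comp_def, entryCLM_map] at h4
      exact h4.unique h5
    have hspaceD : HasFDerivAt (fun z => κ (w t z)) (D.comp (ContinuousLinearMap.inr ℝ ℝ (Coord d)))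
        (φ x) := by
      have h3 : HasFDerivAt (fun z : Coord d => (t, z)) (ContinuousLinearMap.inr ℝ ℝ (Coord d))
          (φ x) := hasFDerivAt_prodMk_right t (φ x)
      exact hWd.comp (φ x) h3
    rw [algEquiv_vectorOp κ (hX x hx) hφx hspaceD.differentiableAt,
      (show HasFDerivAt (fun w' => κ (w t (φ w'))) _ x from
        hspaceD.comp x hφx.hasFDerivAt).fderiv] at htime
    -- Along the characteristic the spatial part of the evolution equation drops out, and only the
    -- zeroth-order term remains.
    have hsplit : D (1, fderiv ℝ φ x (-x)) = pullConn κ A φ x x * κ (w t (φ x)) := by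
      have : ((1 : ℝ), fderiv ℝ φ x (-x)) = (1, 0) - (0, fderiv ℝ φ x x) := by simp
      rw [this, map_sub, htime]
      simp
    rw [hsplit] at h2
    refine (h1.mul h2).congr_deriv ?_
    simp [hxdef, mul_assoc]

theorem tendsto_transport {S : Set (Coord d)} (hS : IsOpen S)
    (h0 : (0 : Coord d) ∈ S) {ψ ξ : Coord d → 𝓐} (hξ : ContDiffOn ℝ 1 ξ S) (hξ0 : ξ 0 = 1)
    (v : Coord d) :
    Tendsto (fun s : ℝ => κ.symm (ψ v * ξ (Real.exp (Real.log (1 - s)) • v))) (𝓝[<] 1)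
      (𝓝 (κ.symm (ψ v))) := by
  refine (continuous_symm_algEquiv κ).continuousAt.tendsto.comp ?_
  have hc : ContinuousAt ξ ((0 : ℝ) • v) := by
    rw [zero_smul]; exact hξ.continuousOn.continuousAt (hS.mem_nhds h0)
  have h1 : Tendsto (fun s : ℝ => (1 - s) • v) (𝓝[<] 1) (𝓝 ((0 : ℝ) • v)) := by
    have : Continuous fun s : ℝ => (1 - s) • v := by fun_prop
    simpa using (this.tendsto 1).mono_left nhdsWithin_le_nhds
  have h2 : Tendsto (fun s : ℝ => ψ v * ξ ((1 - s) • v)) (𝓝[<] 1) (𝓝 (ψ v)) := by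
    simpa [hξ0] using (hc.tendsto.comp h1).const_mul (ψ v)
  refine h2.congr' ?_
  filter_upwards [self_mem_nhdsWithin] with s hs
  rw [Real.exp_log (by simpa using hs)]

end RadialOperator

end OrdExp

namespace OrdExp

/-! ### The ordered exponential as the Picard series. -/

section RadialSeries

set_option maxSynthPendingDepth 3

variable {d : ℕ} {ι : Type*} [Fintype ι] [DecidableEq ι]
  {𝓐 : Type*} [NormedRing 𝓐] [NormedAlgebra ℝ 𝓐]
  (κ : Matrix ι ι ℝ ≃ₐ[ℝ] 𝓐) {A : Fin d → Coord d → Matrix ι ι ℝ}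

theorem div_sub_mem_Icc {a b s : ℝ} (hab : a < b) (hs : s ∈ Icc a b) :
    (s - a) / (b - a) ∈ Icc (0 : ℝ) 1 :=
  ⟨div_nonneg (by linarith [hs.1]) (by linarith), (div_le_one (by linarith)).2 (by linarith [hs.2])⟩

theorem velocity_radial {φ : OpenPartialHomeomorph (Coord d) (Coord d)}
    (hst : StarConvex ℝ 0 φ.source) (hφ : ContDiffOn ℝ ∞ φ φ.source) {v : Coord d}
    (hv : v ∈ φ.source) {a b : ℝ} (hab : a < b) {γ : ℝ → Coord d}
    (hγ : ∀ s ∈ Icc a b, γ s = φ (((s - a) / (b - a)) • v)) {s : ℝ} (hs : s ∈ Icc a b) :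
    velocity a b γ s = (b - a)⁻¹ • fderiv ℝ φ (((s - a) / (b - a)) • v) v := by
  have hx := hst.smul_mem_of_mem_Icc hv (div_sub_mem_Icc hab hs)
  have hd := ((hφ.differentiableOn (by simp)).differentiableAt
    (φ.open_source.mem_nhds hx)).hasFDerivAt
  have hl : HasDerivAt (fun s : ℝ => ((s - a) / (b - a)) • v) ((b - a)⁻¹ • v) s := by
    have := (((hasDerivAt_id s).sub_const a).div_const (b - a)).smul_const v
    simpa using this
  have h := (hd.comp_hasDerivAt s hl).hasDerivWithinAt (s := Icc a b)
  rw [map_smul] at h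
  exact (h.congr hγ (hγ s hs)).derivWithin (uniqueDiffOn_Icc hab s hs)

variable [FiniteDimensional ℝ 𝓐]

/-- Both sides obey the same recursion once `[a, b]` is rescaled to `[0, 1]`. The velocity
contributes the factor `(b - a)⁻¹` absorbed by the change of variables, and the sign comes from
`negMulLeft`. -/
theorem algEquiv_iterInt {φ : OpenPartialHomeomorph (Coord d) (Coord d)}
    (hst : StarConvex ℝ 0 φ.source) (hφ : ContDiffOn ℝ ∞ φ φ.source)
    (hA : ∀ μ i j, ContDiffOn ℝ ∞ (fun z => A μ z i j) φ.target) {v : Coord d}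
    (hv : v ∈ φ.source) {a b : ℝ} (hab : a < b) {γ : ℝ → Coord d}
    (hγ : ∀ s ∈ Icc a b, γ s = φ (((s - a) / (b - a)) • v)) (k : ℕ) :
    ∀ s ∈ Icc a b, κ ((-1 : ℝ) ^ k • iterInt A a b γ k s) =
      radialTerm (negMulLeft (pullConn κ A φ)) 1 k (((s - a) / (b - a)) • v) := by
  have : CompleteSpace 𝓐 := FiniteDimensional.complete ℝ 𝓐
  have hS := φ.open_source
  set α := pullConn κ A φ with hαdef
  have hα : ContDiffOn ℝ 1 α φ.source := contDiffOn_pullConn κ hφ hA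
  have hα' := hα.negMulLeft
  have hda : ∀ v ∈ φ.source, HasFDerivAt (negMulLeft α) (fderiv ℝ (negMulLeft α) v) v :=
    fun v hv => ((hα'.differentiableOn one_ne_zero).differentiableAt (hS.mem_nhds hv)).hasFDerivAt
  have hspec := fun k => radialTerm_spec (w₀ := (1 : 𝓐)) hS hst hda
    (hα'.continuousOn_fderiv_of_isOpen hS le_rfl) k
  induction k with
  | zero => intro s _; simp [iterInt, radialTerm]
  | succ k ih =>
    intro s hs
    set f := radialTerm (negMulLeft α) 1 k with hf
    have hfc : ContinuousOn f φ.source := fun w hw =>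
      ((hspec k).1 w hw).continuousAt.continuousWithinAt
    set G : ℝ → 𝓐 := fun r => negMulLeft α (r • v) v (f (r • v)) with hG
    have hGc : ContinuousOn G (Icc 0 1) :=
      (continuousOn_radialIntegrand hst hα'.continuousOn hfc).uncurry_left_Icc hv
    have hsub : ∫ r in a..s, (b - a)⁻¹ • G ((r - a) / (b - a)) =
        radialTerm (negMulLeft α) 1 (k + 1) (((s - a) / (b - a)) • v) := by
      rw [radialTerm_smul, intervalIntegral.integral_smul]
      have := intervalIntegral.inv_smul_integral_comp_div_sub (a := a) (b := s) G (b - a)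
        (a / (b - a))
      simp only [← sub_div, sub_self] at this
      exact this
    have hint : IntervalIntegrable (fun r => (b - a)⁻¹ • G ((r - a) / (b - a))) volume a s := by
      apply ContinuousOn.intervalIntegrable
      rw [uIcc_of_le hs.1]
      refine ContinuousOn.const_smul (hGc.comp (by fun_prop) fun r hr => ?_) _
      exact div_sub_mem_Icc hab ⟨hr.1, hr.2.trans hs.2⟩
    rw [← hsub]
    apply κ.symm.injective
    rw [AlgEquiv.symm_apply_apply]
    ext i j
    rw [← entryCLM_apply, ← ContinuousLinearMap.intervalIntegral_comp_comm _ hint]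
    rw [Matrix.smul_apply, iterInt, Matrix.of_apply, ← intervalIntegral.integral_smul]
    refine intervalIntegral.integral_congr fun r hr => ?_
    rw [uIcc_of_le hs.1] at hr
    have hr' : r ∈ Icc a b := ⟨hr.1, hr.2.trans hs.2⟩
    have hK : κ (∑ μ, velocity a b γ r μ • A μ (γ r)) =
        (b - a)⁻¹ • α (((r - a) / (b - a)) • v) v := by
      rw [hαdef, pullConn_apply, velocity_radial hst hφ hv hab hγ hr', hγ r hr', ← map_smul κ,
        Finset.smul_sum]
      simp [smul_smul]
    have e : κ ((-1 : ℝ) ^ (k + 1) • ((∑ μ, velocity a b γ r μ • A μ (γ r)) *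
        iterInt A a b γ k r)) = (b - a)⁻¹ • G ((r - a) / (b - a)) := by
      rw [map_smul, map_mul, hK, hG]
      dsimp only
      rw [negMulLeft_apply, ← ih r hr', map_smul, pow_succ, mul_neg_one, neg_smul, smul_neg,
        mul_smul_comm, smul_mul_assoc, smul_comm]
    have e' := congrArg (entryCLM κ i j) e
    rw [entryCLM_map] at e'
    exact e'

theorem hasSum_orderedExpTerm {φ : OpenPartialHomeomorph (Coord d) (Coord d)}
    (hst : StarConvex ℝ 0 φ.source) (hφ : ContDiffOn ℝ ∞ φ φ.source)
    (hA : ∀ μ i j, ContDiffOn ℝ ∞ (fun z => A μ z i j) φ.target) {v : Coord d}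
    (hv : v ∈ φ.source) {a b : ℝ} (hab : a < b) {γ : ℝ → Coord d}
    (hγ : ∀ s ∈ Icc a b, γ s = φ (((s - a) / (b - a)) • v)) {x : 𝓐}
    (hx : HasSum (fun k => radialTerm (negMulLeft (pullConn κ A φ)) 1 k v) x) :
    HasSum (orderedExpTerm A a b γ) (κ.symm x) := by
  have h := hx.map κ.symm (continuous_symm_algEquiv κ)
  convert h using 1
  ext1 k
  have := algEquiv_iterInt κ hst hφ hA hv hab hγ k b (right_mem_Icc.2 hab.le)
  rw [div_self (by linarith), one_smul] at this
  rw [Function.comp_apply, ← this, AlgEquiv.symm_apply_apply, orderedExpTerm]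

end RadialSeries

section RadialTheorem

variable {d : ℕ} {ι : Type*} [Fintype ι] [DecidableEq ι]
  {A : Fin d → Coord d → Matrix ι ι ℝ} {X : Fin d → Coord d → ℝ}

/-- Parallel transport `P` along the rays of a normal chart `φ`, as the limit of the operator
exponential of the radial operator and as the sum of the series of iterated integrals. -/
theorem exists_radial_transport {φ : OpenPartialHomeomorph (Coord d) (Coord d)}
    (h0 : (0 : Coord d) ∈ φ.source) (hst : StarConvex ℝ 0 φ.source)
    (hφ : ContDiffOn ℝ ∞ φ φ.source) (hφ' : ContDiffOn ℝ ∞ φ.symm φ.target)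
    (hX : ∀ v ∈ φ.source, ∀ ρ, X ρ (φ v) = fderiv ℝ φ v v ρ)
    (hA : ∀ μ i j, ContDiffOn ℝ ∞ (fun z => A μ z i j) φ.target) :
    ∃ P : Coord d → Matrix ι ι ℝ,
      (∃ u, IsOperatorExp φ.target (vectorOp A X) (fun _ => 1) u ∧
        (∀ w, IsOperatorExp φ.target (vectorOp A X) (fun _ => 1) w →
          ∀ τ ≤ 0, ∀ z ∈ φ.target, w τ z = u τ z) ∧
        ∀ v ∈ φ.source, Tendsto (fun s : ℝ => u (Real.log (1 - s)) (φ v)) (𝓝[<] 1) (𝓝 (P v))) ∧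
      P 0 = 1 ∧ (∀ i j, ContDiffOn ℝ 1 (fun v => P v i j) φ.source) ∧
      (∀ v ∈ φ.source, ∀ i j, fderiv ℝ (fun v => P v i j) v v =
        -((∑ μ, fderiv ℝ φ v v μ • A μ (φ v)) * P v) i j) ∧
      ∀ v ∈ φ.source, ∀ a b : ℝ, a < b → ∀ γ : ℝ → Coord d,
        (∀ s ∈ Icc a b, γ s = φ (((s - a) / (b - a)) • v)) →
          HasSum (orderedExpTerm A a b γ) (P v) := by
  -- Matrices acting on Euclidean space carry the operator norm, which makes them a complete normed
  -- algebra; Dedekind finiteness is inherited from square matrices.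
  let κ : Matrix ι ι ℝ ≃ₐ[ℝ] (EuclideanSpace ℝ ι →L[ℝ] EuclideanSpace ℝ ι) :=
    (Matrix.toEuclideanCLM (n := ι) (𝕜 := ℝ)).toAlgEquiv
  have hfin : FiniteDimensional ℝ (EuclideanSpace ℝ ι →L[ℝ] EuclideanSpace ℝ ι) :=
    LinearEquiv.finiteDimensional κ.toLinearEquiv
  have hded : IsDedekindFiniteMonoid (EuclideanSpace ℝ ι →L[ℝ] EuclideanSpace ℝ ι) := by
    refine ⟨fun {x y} h => κ.symm.injective ?_⟩
    have h' := congrArg κ.symm h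
    rw [map_mul, map_one, mul_eq_one_comm] at h'
    rw [map_mul, map_one, h']
  obtain ⟨ψ, ξ, hψ, hξ, hψ0, hξ0, hψd, hξd, hψξ, hsum⟩ :=
    exists_ray_transport φ.open_source hst (contDiffOn_pullConn κ hφ hA)
  refine ⟨fun v => κ.symm (ψ v), ⟨_, isOperatorExp_of_transport κ hst hφ hφ' hX hψ hξ hψd hψξ,
    ?_, ?_⟩, by simp [hψ0], ?_, ?_, ?_⟩
  · intro w hw τ hτ z hz
    have := hw.eq_of_transport κ hst hφ hX hξ hξd hψξ hτ (φ.map_target hz)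
    rw [φ.right_inv hz] at this
    rw [← this, AlgEquiv.symm_apply_apply]
  · intro v hv
    simpa only [φ.left_inv hv] using tendsto_transport κ φ.open_source h0 hξ hξ0 v
  · exact fun i j => (entryCLM κ i j).contDiff.comp_contDiffOn hψ
  · intro v hv i j
    have h := ((hψ.differentiableOn one_ne_zero).differentiableAt
      (φ.open_source.mem_nhds hv)).hasFDerivAt
    have h2 := ((entryCLM κ i j).hasFDerivAt.comp v h).fderiv
    have e : (fun v => κ.symm (ψ v) i j) = entryCLM κ i j ∘ ψ := rfl
    rw [e, h2, ContinuousLinearMap.comp_apply, hψd v hv, pullConn_apply, map_neg, entryCLM_apply,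
      map_mul, AlgEquiv.symm_apply_apply]
  · exact fun v hv a b hab γ hγ => hasSum_orderedExpTerm κ hst hφ hA hv hab hγ (hsum v hv)

end RadialTheorem

end OrdExp

namespace OrdExp

/-! ### The metric as a bilinear form and the Christoffel symbols. -/

section MetricForm

set_option maxSynthPendingDepth 3

variable {d : ℕ}

/-- The bilinear form `u, w ↦ g_{μν}(z) u^μ w^ν`. -/
noncomputable def gform (G : Coord d → Matrix (Fin d) (Fin d) ℝ) (z : Coord d) :
    Coord d →L[ℝ] Coord d →L[ℝ] ℝ :=
  ∑ μ, ∑ ν, G z μ ν • (EuclideanSpace.proj μ : Coord d →L[ℝ] ℝ).smulRight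
    (EuclideanSpace.proj ν : Coord d →L[ℝ] ℝ)

/-- The matrix function `G` is a smooth positive definite metric on `V`. -/
structure IsMetricOn (G : Coord d → Matrix (Fin d) (Fin d) ℝ) (V : Set (Coord d)) : Prop where
  isOpen : IsOpen V
  smooth : ∀ μ ν, ContDiffOn ℝ ∞ (fun z => G z μ ν) V
  symm : ∀ z ∈ V, ∀ μ ν, G z μ ν = G z ν μ
  pos : ∀ z ∈ V, ∀ u, u ≠ 0 → 0 < gform G z u u

variable {G : Coord d → Matrix (Fin d) (Fin d) ℝ} {V : Set (Coord d)}

theorem gform_apply (z u w : Coord d) : gform G z u w = ∑ μ, ∑ ν, G z μ ν * u μ * w ν := by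
  simp [gform, mul_assoc]

namespace IsMetricOn

variable (hG : IsMetricOn G V)

include hG

theorem gform_symm {z : Coord d} (hz : z ∈ V) (u w : Coord d) : gform G z u w = gform G z w u := by
  rw [gform_apply, gform_apply, Finset.sum_comm]
  refine Finset.sum_congr rfl fun μ _ => Finset.sum_congr rfl fun ν _ => ?_
  rw [hG.symm z hz]; ring

theorem gform_self_nonneg {z : Coord d} (hz : z ∈ V) (u : Coord d) : 0 ≤ gform G z u u := by
  rcases eq_or_ne u 0 with rfl | hu
  · simp
  · exact (hG.pos z hz u hu).le

theorem isUnit_det {z : Coord d} (hz : z ∈ V) : IsUnit (G z).det := by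
  rw [isUnit_iff_ne_zero]
  intro h
  obtain ⟨u, hu, h0⟩ := Matrix.exists_mulVec_eq_zero_iff.2 h
  have hu' : WithLp.toLp 2 u ≠ (0 : Coord d) := fun h => hu (by simpa using h)
  refine (hG.pos z hz _ hu').ne' ?_
  rw [hG.gform_symm hz, gform_apply, Finset.sum_comm]
  have : ∀ ν, ∑ μ, G z μ ν * u μ * u ν = 0 := fun ν => by
    have h1 := congrFun h0 ν
    rw [Matrix.mulVec, dotProduct] at h1
    rw [← Finset.sum_mul]
    simp only [hG.symm z hz _ ν, h1, Pi.zero_apply, zero_mul]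
  simp [this]

theorem contDiffOn_gform : ContDiffOn ℝ ∞ (gform G) V :=
  ContDiffOn.sum fun μ _ => ContDiffOn.sum fun ν _ => (hG.smooth μ ν).smul contDiffOn_const

theorem hasFDerivAt_gform {z : Coord d} (hz : z ∈ V) :
    HasFDerivAt (gform G) (fderiv ℝ (gform G) z) z :=
  ((hG.contDiffOn_gform.differentiableOn (by simp)).differentiableAt
    (hG.isOpen.mem_nhds hz)).hasFDerivAt

theorem fderiv_gform_apply {z : Coord d} (hz : z ∈ V) (a u w : Coord d) :
    fderiv ℝ (gform G) z a u w = ∑ μ, ∑ ν, fderiv ℝ (fun x => G x μ ν) z a * u μ * w ν := by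
  have h : HasFDerivAt (gform G) (∑ μ, ∑ ν, (fderiv ℝ (fun x => G x μ ν) z).smulRight
      ((EuclideanSpace.proj μ : Coord d →L[ℝ] ℝ).smulRight
        (EuclideanSpace.proj ν : Coord d →L[ℝ] ℝ))) z := by
    refine HasFDerivAt.fun_sum fun μ _ => HasFDerivAt.fun_sum fun ν _ => ?_
    exact HasFDerivAt.smul_const (((hG.smooth μ ν).differentiableOn (by simp)).differentiableAt
      (hG.isOpen.mem_nhds hz)).hasFDerivAt _
  rw [h.fderiv]
  simp [mul_assoc]

theorem fderiv_gform_symm {z : Coord d} (hz : z ∈ V) (a u w : Coord d) :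
    fderiv ℝ (gform G) z a u w = fderiv ℝ (gform G) z a w u := by
  rw [hG.fderiv_gform_apply hz, hG.fderiv_gform_apply hz, Finset.sum_comm]
  refine Finset.sum_congr rfl fun μ _ => Finset.sum_congr rfl fun ν _ => ?_
  have : (fun x => G x ν μ) =ᶠ[𝓝 z] fun x => G x μ ν := by
    filter_upwards [hG.isOpen.mem_nhds hz] with x hx using hG.symm x hx ν μ
  rw [this.fderiv_eq]; ring

/-- The contracted Christoffel symbols solve the linear system given by the metric. -/
theorem gform_christoffel {z : Coord d} (hz : z ∈ V) (u w q : Coord d)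
    (hq : ∀ ρ, q ρ = ∑ μ, ∑ ν, christoffel G ρ μ ν z * u μ * u ν) :
    gform G z q w = fderiv ℝ (gform G) z u u w - fderiv ℝ (gform G) z w u u / 2 := by
  set e : Fin d → Coord d := fun α => EuclideanSpace.single α 1 with he
  -- `T` is the contracted Christoffel symbol with lowered index. Two of its three terms coincide
  -- after symmetrization in `μ`, `ν`.
  set T : Fin d → ℝ := fun α =>
    fderiv ℝ (gform G) z u u (e α) - fderiv ℝ (gform G) z (e α) u u / 2 with hT
  have hexp : ∀ f : Coord d → ℝ, ∀ a : Coord d, fderiv ℝ f z a = ∑ μ, a μ * pd μ f z := by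
    intro f a
    conv_lhs => rw [coord_eq_sum a, map_sum]
    simp [pd]
  have hTα : ∀ α, T α = ∑ μ, ∑ ν, (1 / 2) * (pd ν (fun w => G w α μ) z +
      pd μ (fun w => G w α ν) z - pd α (fun w => G w μ ν) z) * u μ * u ν := by
    intro α
    have h1 : fderiv ℝ (gform G) z u u (e α) =
        ∑ μ, ∑ ν, pd ν (fun w => G w α μ) z * u μ * u ν := by
      rw [hG.fderiv_gform_symm hz, hG.fderiv_gform_apply hz, Finset.sum_eq_single α]
      · refine Finset.sum_congr rfl fun μ _ => ?_
        rw [hexp, he]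
        simp only [PiLp.single_apply, if_true, mul_one, Finset.sum_mul]
        exact Finset.sum_congr rfl fun ν _ => by ring
      · intro β _ hβ
        simp [he, hβ]
      · simp
    have h2 : ∑ μ, ∑ ν, pd μ (fun w => G w α ν) z * u μ * u ν =
        ∑ μ, ∑ ν, pd ν (fun w => G w α μ) z * u μ * u ν := by
      rw [Finset.sum_comm]
      exact Finset.sum_congr rfl fun μ _ => Finset.sum_congr rfl fun ν _ => by ring
    have h3 : fderiv ℝ (gform G) z (e α) u u =
        ∑ μ, ∑ ν, pd α (fun w => G w μ ν) z * u μ * u ν := by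
      rw [hG.fderiv_gform_apply hz]; rfl
    rw [hT]
    dsimp only
    have : ∀ μ ν, (1 / 2) * (pd ν (fun w => G w α μ) z +
        pd μ (fun w => G w α ν) z - pd α (fun w => G w μ ν) z) * u μ * u ν =
        (1 / 2) * (pd ν (fun w => G w α μ) z * u μ * u ν) +
        (1 / 2) * (pd μ (fun w => G w α ν) z * u μ * u ν) -
        (1 / 2) * (pd α (fun w => G w μ ν) z * u μ * u ν) := fun μ ν => by ring
    simp only [this, Finset.sum_add_distrib, Finset.sum_sub_distrib, ← Finset.mul_sum, h2]
    rw [h1, h3]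
    ring
  have hqT : ∀ ρ, q ρ = ∑ α, (G z)⁻¹ ρ α * T α := by
    intro ρ
    rw [hq]
    simp only [hTα, christoffel, Finset.sum_mul, Finset.mul_sum]
    rw [Finset.sum_congr rfl fun μ _ => Finset.sum_comm, Finset.sum_comm]
    refine Finset.sum_congr rfl fun α _ => Finset.sum_congr rfl fun μ _ =>
      Finset.sum_congr rfl fun ν _ => ?_
    ring
  have hw : ∑ σ, T σ * w σ = fderiv ℝ (gform G) z u u w - fderiv ℝ (gform G) z w u u / 2 := by
    conv_rhs => rw [coord_eq_sum w]
    simp only [map_sum, map_smul, smul_eq_mul, FunLike.coe_sum, Finset.sum_apply,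
      _root_.smul_apply, Finset.sum_div]
    rw [← Finset.sum_sub_distrib]
    refine Finset.sum_congr rfl fun σ _ => ?_
    rw [hT, he]
    ring
  rw [← hw, gform_apply, Finset.sum_comm]
  refine Finset.sum_congr rfl fun σ _ => ?_
  rw [← Finset.sum_mul]
  congr 1
  have hinv := Matrix.mul_nonsing_inv (G z) (hG.isUnit_det hz)
  have h1 : G z *ᵥ ((G z)⁻¹ *ᵥ T) = T := by rw [Matrix.mulVec_mulVec, hinv, Matrix.one_mulVec]
  have h2 := congrFun h1 σ
  rw [Matrix.mulVec, dotProduct] at h2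
  rw [← h2]
  refine Finset.sum_congr rfl fun ρ _ => ?_
  rw [hG.symm z hz ρ σ, hqT]
  rfl

end IsMetricOn

end MetricForm

end OrdExp

/-! ### Uniqueness of integral curves. -/

section Uniqueness

variable {E : Type*} [NormedAddCommGroup E] [NormedSpace ℝ E]

theorem HasDerivWithinAt.Ici_of_Icc {f : ℝ → E} {f' : E} {a b t : ℝ}
    (h : HasDerivWithinAt f f' (Icc a b) t) (ht : t ∈ Ico a b) : HasDerivWithinAt f f' (Ici t) t :=
  h.mono_of_mem_nhdsWithin <| mem_of_superset (Icc_mem_nhdsGE ht.2) (Icc_subset_Icc_left ht.1)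

/-- Two integral curves of a `C^1` vector field with the same initial value coincide. -/
theorem integralCurve_eqOn_Icc {F : E → E} {U : Set E} (hU : IsOpen U) (hF : ContDiffOn ℝ 1 F U)
    {a b : ℝ} {p q : ℝ → E} (hp : ∀ t ∈ Icc a b, HasDerivWithinAt p (F (p t)) (Icc a b) t)
    (hq : ∀ t ∈ Icc a b, HasDerivWithinAt q (F (q t)) (Icc a b) t)
    (hpU : ∀ t ∈ Icc a b, p t ∈ U) (h0 : p a = q a) :
    EqOn p q (Icc a b) := by
  have hpc : ContinuousOn p (Icc a b) := fun t ht => (hp t ht).continuousWithinAt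
  have hqc : ContinuousOn q (Icc a b) := fun t ht => (hq t ht).continuousWithinAt
  rcases lt_or_ge b a with hab | hab
  · simp [Icc_eq_empty_of_lt hab]
  -- The coincidence set is closed, and local Lipschitz uniqueness extends it to the right of each
  -- of its points. The curve `q` need not be assumed to stay in `U`, since this is used only where
  -- it meets `p`.
  have hcl : IsClosed ({t | p t = q t} ∩ Icc a b) := by
    have := hpc.prodMk hqc |>.preimage_isClosed_of_isClosed isClosed_Icc isClosed_diagonal
    rwa [inter_comm] at this
  refine hcl.Icc_subset_of_forall_mem_nhdsWithin h0 ?_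
  rintro t ⟨hpq, ht⟩
  have htI := Ico_subset_Icc_self ht
  obtain ⟨K, W, hW, hL⟩ := (hF.contDiffAt (hU.mem_nhds (hpU t htI))).exists_lipschitzOnWith
  have hle : 𝓝[≥] t ≤ 𝓝[Icc a b] t :=
    nhdsWithin_le_of_mem (mem_of_superset (Icc_mem_nhdsGE ht.2) (Icc_subset_Icc_left ht.1))
  have h1 : ∀ᶠ r in 𝓝[≥] t, p r ∈ W ∧ q r ∈ W := by
    have hW' : W ∈ 𝓝 (q t) := by rwa [← show p t = q t from hpq]
    exact (((hpc t htI).mono_left hle).eventually hW).and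
      (((hqc t htI).mono_left hle).eventually hW')
  obtain ⟨c, hc, hcb⟩ := (mem_nhdsGE_iff_exists_mem_Ioc_Ico_subset ht.2).1 h1
  have hsub : Icc t c ⊆ Icc a b := Icc_subset_Icc ht.1 hc.2
  have := ODE_solution_unique_of_mem_Icc_right (v := fun _ => F) (s := fun _ => W) (K := K)
    (f := p) (g := q) (a := t) (b := c) (fun _ _ => hL) (hpc.mono hsub)
    (fun r hr => (hp r (hsub (Ico_subset_Icc_self hr))).Ici_of_Icc
      ⟨ht.1.trans hr.1, hr.2.trans_le hc.2⟩)
    (fun r hr => (hcb hr).1) (hqc.mono hsub)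
    (fun r hr => (hq r (hsub (Ico_subset_Icc_self hr))).Ici_of_Icc
      ⟨ht.1.trans hr.1, hr.2.trans_le hc.2⟩)
    (fun r hr => (hcb hr).2) hpq
  exact mem_of_superset (Ioc_mem_nhdsGT hc.1) fun r hr => this (Ioc_subset_Icc_self hr)

end Uniqueness

namespace OrdExp

/-! ### Smoothness of determinants and inverse matrices. -/

section Smoothness

set_option maxSynthPendingDepth 3

variable {E : Type*} [NormedAddCommGroup E] [NormedSpace ℝ E] {n : Type*} [Fintype n]
  [DecidableEq n] {k : WithTop ℕ∞} {s : Set E} {H : E → Matrix n n ℝ}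

theorem contDiffOn_det (hH : ∀ i j, ContDiffOn ℝ k (fun z => H z i j) s) :
    ContDiffOn ℝ k (fun z => (H z).det) s := by
  simp only [Matrix.det_apply]
  exact ContDiffOn.sum fun σ _ => (contDiffOn_prod fun i _ => hH _ _).const_smul _

theorem contDiffOn_inv_apply (hH : ∀ i j, ContDiffOn ℝ k (fun z => H z i j) s)
    (hu : ∀ z ∈ s, IsUnit (H z).det) (i j : n) : ContDiffOn ℝ k (fun z => (H z)⁻¹ i j) s := by
  have e : ∀ z, (H z)⁻¹ i j = (H z).det⁻¹ * ((H z).updateRow j (Pi.single i 1)).det := fun z => by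
    rw [Matrix.inv_def, Matrix.smul_apply, Matrix.adjugate_apply, Ring.inverse_eq_inv, smul_eq_mul]
  simp only [e]
  refine ((contDiffOn_det hH).inv fun z hz => (hu z hz).ne_zero).mul (contDiffOn_det fun a b => ?_)
  by_cases ha : a = j
  · simp only [ha, Matrix.updateRow_self]; exact contDiffOn_const
  · simp only [Matrix.updateRow_ne ha]; exact hH a b

end Smoothness

/-! ### Geodesics as integral curves, their reparametrization and constant speed. -/

section Geodesics

set_option maxSynthPendingDepth 3

variable {d : ℕ} {G : Coord d → Matrix (Fin d) (Fin d) ℝ} {V : Set (Coord d)}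

theorem IsMetricOn.contDiffOn_christoffel (hG : IsMetricOn G V) (ρ μ ν : Fin d) :
    ContDiffOn ℝ ∞ (christoffel G ρ μ ν) V := by
  have hpd : ∀ α β γ, ContDiffOn ℝ ∞ (pd α fun w => G w β γ) V := fun α β γ =>
    ((hG.smooth β γ).fderiv_of_isOpen hG.isOpen (by simp)).clm_apply contDiffOn_const
  refine ContDiffOn.sum fun α _ => ContDiffOn.mul ?_ ((hpd _ _ _).add (hpd _ _ _) |>.sub (hpd _ _ _))
  exact (contDiffOn_inv_apply hG.smooth (fun z hz => hG.isUnit_det hz) ρ α).div_const 2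

/-- The geodesic vector field on the tangent bundle. -/
noncomputable def geodesicField (G : Coord d → Matrix (Fin d) (Fin d) ℝ)
    (p : Coord d × Coord d) : Coord d × Coord d :=
  (p.2, WithLp.toLp 2 fun ρ => -∑ μ, ∑ ν, christoffel G ρ μ ν p.1 * p.2 μ * p.2 ν)

theorem IsMetricOn.contDiffOn_geodesicField (hG : IsMetricOn G V) :
    ContDiffOn ℝ 1 (geodesicField G) (V ×ˢ univ) := by
  refine contDiffOn_snd.prodMk (contDiffOn_euclidean.2 fun ρ => ?_)
  refine ContDiffOn.neg (ContDiffOn.sum fun μ _ => ContDiffOn.sum fun ν _ => ?_)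
  have h1 : ContDiffOn ℝ 1 (fun p : Coord d × Coord d => christoffel G ρ μ ν p.1) (V ×ˢ univ) :=
    ((hG.contDiffOn_christoffel ρ μ ν).of_le (by norm_cast)).comp contDiffOn_fst fun p hp => hp.1
  have h2 : ∀ μ, ContDiffOn ℝ 1 (fun p : Coord d × Coord d => p.2 μ) (V ×ˢ univ) := fun μ =>
    ((EuclideanSpace.proj μ : Coord d →L[ℝ] ℝ).contDiff.comp contDiff_snd).contDiffOn
  exact (h1.mul (h2 μ)).mul (h2 ν)

variable {a b : ℝ} {γ : ℝ → Coord d}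

theorem IsGeodesic.hasDerivWithinAt (h : IsGeodesic G V a b γ) {s : ℝ} (hs : s ∈ Icc a b) :
    HasDerivWithinAt γ (velocity a b γ s) (Icc a b) s :=
  (h.contDiffOn.differentiableOn (by simp) s hs).hasDerivWithinAt

theorem IsGeodesic.hasDerivWithinAt_velocity (h : IsGeodesic G V a b γ) (hab : a < b) {s : ℝ}
    (hs : s ∈ Icc a b) :
    HasDerivWithinAt (velocity a b γ) (geodesicField G (γ s, velocity a b γ s)).2 (Icc a b) s := by
  have h1 : ContDiffOn ℝ 1 (velocity a b γ) (Icc a b) :=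
    h.contDiffOn.derivWithin (uniqueDiffOn_Icc hab) (by norm_num)
  have h2 := (h1.differentiableOn one_ne_zero s hs).hasDerivWithinAt
  refine h2.congr_deriv ?_
  ext ρ
  have h3 := ((EuclideanSpace.proj ρ : Coord d →L[ℝ] ℝ).hasFDerivAt.comp_hasDerivWithinAt s h2)
  have h4 := h3.derivWithin (uniqueDiffOn_Icc hab s hs)
  have h5 := h.eqn s hs ρ
  change derivWithin (fun r => velocity a b γ r ρ) (Icc a b) s = _ at h4
  rw [h4] at h5
  exact eq_neg_of_add_eq_zero_left h5

theorem IsGeodesic.hasDerivWithinAt_state (h : IsGeodesic G V a b γ) (hab : a < b) {s : ℝ}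
    (hs : s ∈ Icc a b) :
    HasDerivWithinAt (fun s => (γ s, velocity a b γ s)) (geodesicField G (γ s, velocity a b γ s))
      (Icc a b) s :=
  (h.hasDerivWithinAt hs).prodMk (h.hasDerivWithinAt_velocity hab hs)

theorem IsGeodesic.eqOn (hG : IsMetricOn G V) {γ' : ℝ → Coord d} (hab : a < b)
    (h : IsGeodesic G V a b γ) (h' : IsGeodesic G V a b γ') (h0 : γ a = γ' a)
    (hv : velocity a b γ a = velocity a b γ' a) : EqOn γ γ' (Icc a b) := by
  have := integralCurve_eqOn_Icc (hG.isOpen.prod isOpen_univ) hG.contDiffOn_geodesicField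
    (fun t ht => h.hasDerivWithinAt_state hab ht) (fun t ht => h'.hasDerivWithinAt_state hab ht)
    (fun t ht => ⟨h.mapsTo ht, mem_univ _⟩)
    (by simp [h0, hv])
  exact fun t ht => congrArg Prod.fst (this ht)

theorem velocity_comp_affine {c e m n : ℝ} (hce : c < e) (hγ : ContDiffOn ℝ 2 γ (Icc a b))
    (hm : ∀ s ∈ Icc c e, m * s + n ∈ Icc a b) {s : ℝ} (hs : s ∈ Icc c e) :
    velocity c e (fun s => γ (m * s + n)) s = m • velocity a b γ (m * s + n) := by
  have h1 : HasDerivWithinAt (fun s : ℝ => m * s + n) m (Icc c e) s := by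
    simpa using (((hasDerivAt_id s).const_mul m).add_const n).hasDerivWithinAt
  have h2 := (hγ.differentiableOn (by simp) _ (hm s hs)).hasDerivWithinAt
  exact (h2.scomp s h1 hm).derivWithin (uniqueDiffOn_Icc hce s hs)

/-- Affine reparametrizations of geodesics are geodesics. -/
theorem IsGeodesic.comp_affine {c e m n : ℝ} (hab : a < b) (hce : c < e)
    (h : IsGeodesic G V a b γ) (hm : ∀ s ∈ Icc c e, m * s + n ∈ Icc a b) :
    IsGeodesic G V c e (fun s => γ (m * s + n)) where
  mapsTo s hs := h.mapsTo (hm s hs)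
  contDiffOn := h.contDiffOn.comp (by fun_prop) hm
  eqn s hs ρ := by
    have h1 : HasDerivWithinAt (fun s : ℝ => m * s + n) m (Icc c e) s := by
      simpa using (((hasDerivAt_id s).const_mul m).add_const n).hasDerivWithinAt
    have h2 := ((h.hasDerivWithinAt_velocity hab (hm s hs)).scomp s h1 hm).const_smul m
    have h3 : HasDerivWithinAt (velocity c e fun s => γ (m * s + n))
        (m • m • (geodesicField G (γ (m * s + n), velocity a b γ (m * s + n))).2) (Icc c e) s :=
      h2.congr (fun r hr => velocity_comp_affine hce h.contDiffOn hm hr)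
        (velocity_comp_affine hce h.contDiffOn hm hs)
    have h4 := ((EuclideanSpace.proj ρ : Coord d →L[ℝ] ℝ).hasFDerivAt.comp_hasDerivWithinAt s
      h3).derivWithin (uniqueDiffOn_Icc hce s hs)
    change derivWithin (fun r => velocity c e (fun s => γ (m * s + n)) r ρ) (Icc c e) s = _ at h4
    rw [h4, velocity_comp_affine hce h.contDiffOn hm hs]
    simp only [geodesicField, map_smul, smul_eq_mul, PiLp.proj_apply, PiLp.smul_apply, mul_neg,
      Finset.mul_sum]
    rw [neg_add_eq_zero]
    refine Finset.sum_congr rfl fun μ _ => Finset.sum_congr rfl fun ν _ => ?_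
    ring

/-- The geodesic equation in weak form. -/
theorem IsGeodesic.gform_acceleration (hG : IsMetricOn G V) (h : IsGeodesic G V a b γ) {s : ℝ}
    (hs : s ∈ Icc a b) (w : Coord d) :
    gform G (γ s) (geodesicField G (γ s, velocity a b γ s)).2 w =
      fderiv ℝ (gform G) (γ s) w (velocity a b γ s) (velocity a b γ s) / 2 -
        fderiv ℝ (gform G) (γ s) (velocity a b γ s) (velocity a b γ s) w := by
  have := hG.gform_christoffel (h.mapsTo hs) (velocity a b γ s) w
    (-(geodesicField G (γ s, velocity a b γ s)).2) (fun ρ => by simp [geodesicField])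
  rw [map_neg, neg_apply] at this
  linarith

/-- Geodesics have constant speed. -/
theorem IsGeodesic.gform_velocity_eq (hG : IsMetricOn G V) (hab : a < b)
    (h : IsGeodesic G V a b γ) {s : ℝ} (hs : s ∈ Icc a b) :
    gform G (γ s) (velocity a b γ s) (velocity a b γ s) =
      gform G (γ a) (velocity a b γ a) (velocity a b γ a) := by
  have hd : ∀ r ∈ Icc a b, HasDerivWithinAt
      (fun r => gform G (γ r) (velocity a b γ r) (velocity a b γ r)) 0 (Icc a b) r := by
    intro r hr
    have hv := h.hasDerivWithinAt_velocity hab hr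
    have hg := (hG.hasFDerivAt_gform (h.mapsTo hr)).comp_hasDerivWithinAt r (h.hasDerivWithinAt hr)
    refine ((hg.clm_apply hv).clm_apply hv).congr_deriv ?_
    have h1 := h.gform_acceleration hG hr (velocity a b γ r)
    have h2 := hG.gform_symm (h.mapsTo hr) (velocity a b γ r)
      (geodesicField G (γ r, velocity a b γ r)).2
    simp only [Function.comp_apply, add_apply]
    rw [h2, h1]
    ring
  exact constant_of_has_deriv_right_zero (fun r hr => (hd r hr).continuousWithinAt)
    (fun r hr => (hd r (Ico_subset_Icc_self hr)).Ici_of_Icc hr) s hs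

end Geodesics

end OrdExp

/-! ### The Gauss lemma. -/

section GaussLemma

set_option maxSynthPendingDepth 3

variable {E : Type*} [NormedAddCommGroup E] [NormedSpace ℝ E]

theorem HasFDerivAt.hasDerivAt_ray_apply {F : Type*} [NormedAddCommGroup F] [NormedSpace ℝ F]
    {L : E → E →L[ℝ] F} {L' : E →L[ℝ] E →L[ℝ] F} {v : E} {s : ℝ} (h : HasFDerivAt L L' (s • v))
    (w : E) : HasDerivAt (fun s : ℝ => L (s • v) w) (L' v w) s := by
  have hl : HasDerivAt (fun s : ℝ => s • v) v s := by
    simpa using (hasDerivAt_id s).smul_const v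
  have h1 : HasDerivAt (fun s : ℝ => L (s • v)) (L' v) s := h.comp_hasDerivAt s hl
  simpa using h1.clm_apply (hasDerivAt_const s w)

variable {g : E → E →L[ℝ] E →L[ℝ] ℝ} {φ : E → E} {S : Set E} {B : E →L[ℝ] E →L[ℝ] ℝ}

/-- The derivative of the constant speed identity in the direction of a variation of geodesics. -/
theorem fderiv_speed_variation (hS : IsOpen S) (hst : StarConvex ℝ 0 S) (hφ : ContDiffOn ℝ ∞ φ S)
    (hg : ∀ v ∈ S, HasFDerivAt g (fderiv ℝ g (φ v)) (φ v))
    (hsymm : ∀ v ∈ S, ∀ u w, g (φ v) u w = g (φ v) w u) (hB : ∀ u w, B u w = B w u)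
    (hspeed : ∀ v ∈ S, ∀ s ∈ Icc (0 : ℝ) 1,
      g (φ (s • v)) (fderiv ℝ φ (s • v) v) (fderiv ℝ φ (s • v) v) = B v v)
    {v : E} (hv : v ∈ S) (w : E) {s : ℝ} (hs : s ∈ Icc (0 : ℝ) 1) :
    fderiv ℝ g (φ (s • v)) (s • fderiv ℝ φ (s • v) w) (fderiv ℝ φ (s • v) v)
        (fderiv ℝ φ (s • v) v) +
      2 * g (φ (s • v)) (fderiv ℝ φ (s • v) v)
        (fderiv ℝ φ (s • v) w + s • fderiv ℝ (fderiv ℝ φ) (s • v) v w) = 2 * B v w := by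
  have hm := hst.smul_mem_of_mem_Icc hv hs
  have hD1 : HasFDerivAt φ (fderiv ℝ φ (s • v)) (s • v) :=
    ((hφ.differentiableOn (by simp)).differentiableAt (hS.mem_nhds hm)).hasFDerivAt
  have hD2 : HasFDerivAt (fderiv ℝ φ) (fderiv ℝ (fderiv ℝ φ) (s • v)) (s • v) :=
    (((hφ.fderiv_of_isOpen (m := 1) hS (by norm_cast)).differentiableOn
      one_ne_zero).differentiableAt (hS.mem_nhds hm)).hasFDerivAt
  -- Symmetry of the second derivative: differentiation along the geodesic commutes with the
  -- variation.
  have hsnd : fderiv ℝ (fderiv ℝ φ) (s • v) v w = fderiv ℝ (fderiv ℝ φ) (s • v) w v :=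
    ((hφ.contDiffAt (hS.mem_nhds hm)).isSymmSndFDerivAt
      (by rw [minSmoothness_of_isRCLikeNormedField]; norm_cast)).eq v w
  -- The speed identity is differentiated at `ε = 0` along the variation `v + ε w`, which stays in
  -- the open set `S` for small `ε`.
  have hk : HasDerivAt (fun ε : ℝ => v + ε • w) w 0 := by
    simpa using ((hasDerivAt_id (0 : ℝ)).smul_const w).const_add v
  have hks : HasDerivAt (fun ε : ℝ => s • (v + ε • w)) (s • w) 0 := hk.const_smul s
  have hbase : s • (v + (0 : ℝ) • w) = s • v := by simp
  have hφε : HasDerivAt (fun ε : ℝ => φ (s • (v + ε • w))) (s • fderiv ℝ φ (s • v) w) 0 := by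
    rw [← map_smul]
    exact HasFDerivAt.comp_hasDerivAt (0 : ℝ) (by rwa [hbase]) hks
  have hgε : HasDerivAt (fun ε : ℝ => g (φ (s • (v + ε • w))))
      (fderiv ℝ g (φ (s • v)) (s • fderiv ℝ φ (s • v) w)) 0 :=
    HasFDerivAt.comp_hasDerivAt (0 : ℝ) (by rw [hbase]; exact hg _ hm) hφε
  have hUε : HasDerivAt (fun ε : ℝ => fderiv ℝ φ (s • (v + ε • w)) (v + ε • w))
      (fderiv ℝ φ (s • v) w + s • fderiv ℝ (fderiv ℝ φ) (s • v) v w) 0 := by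
    have h1 : HasDerivAt (fun ε : ℝ => fderiv ℝ φ (s • (v + ε • w)))
        (fderiv ℝ (fderiv ℝ φ) (s • v) (s • w)) 0 :=
      HasFDerivAt.comp_hasDerivAt (0 : ℝ) (by rwa [hbase]) hks
    refine (h1.clm_apply hk).congr_deriv ?_
    rw [hsnd]
    simp [add_comm]
  have hL := (hgε.clm_apply hUε).clm_apply hUε
  have hR : HasDerivAt (fun ε : ℝ => B (v + ε • w) (v + ε • w)) (2 * B v w) 0 := by
    have h1 := ((hasDerivAt_const (0 : ℝ) B).clm_apply hk).clm_apply hk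
    refine h1.congr_deriv ?_
    simp only [zero_smul, add_zero, zero_apply, zero_add, hB w v]
    ring
  have heq : (fun ε : ℝ => B (v + ε • w) (v + ε • w)) =ᶠ[𝓝 0]
      fun ε : ℝ => g (φ (s • (v + ε • w))) (fderiv ℝ φ (s • (v + ε • w)) (v + ε • w))
        (fderiv ℝ φ (s • (v + ε • w)) (v + ε • w)) := by
    have h1 : ∀ᶠ ε : ℝ in 𝓝 0, v + ε • w ∈ S := by
      refine hk.continuousAt.eventually (hS.mem_nhds ?_)
      simpa using hv
    filter_upwards [h1] with ε hε using (hspeed _ hε s hs).symm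
  have hfin := (hL.congr_of_eventuallyEq heq).unique hR
  simp only [zero_smul, add_zero, add_apply] at hfin
  rw [hsymm _ hm (fderiv ℝ φ (s • v) w + s • fderiv ℝ (fderiv ℝ φ) (s • v) v w)] at hfin
  rw [← hfin]
  ring

/-- The Gauss lemma for a family of curves `s ↦ φ (s v)` of constant speed satisfying the geodesic
equation in weak form. -/
theorem gauss_of_weak_geodesic (hS : IsOpen S) (hst : StarConvex ℝ 0 S) (hφ : ContDiffOn ℝ ∞ φ S)
    (hg : ∀ v ∈ S, HasFDerivAt g (fderiv ℝ g (φ v)) (φ v))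
    (hsymm : ∀ v ∈ S, ∀ u w, g (φ v) u w = g (φ v) w u) (hB : ∀ u w, B u w = B w u)
    (hspeed : ∀ v ∈ S, ∀ s ∈ Icc (0 : ℝ) 1,
      g (φ (s • v)) (fderiv ℝ φ (s • v) v) (fderiv ℝ φ (s • v) v) = B v v)
    {v : E} (hv : v ∈ S)
    (hweak : ∀ s ∈ Icc (0 : ℝ) 1, ∀ w, g (φ (s • v)) (fderiv ℝ (fderiv ℝ φ) (s • v) v v) w =
      fderiv ℝ g (φ (s • v)) w (fderiv ℝ φ (s • v) v) (fderiv ℝ φ (s • v) v) / 2 -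
        fderiv ℝ g (φ (s • v)) (fderiv ℝ φ (s • v) v) (fderiv ℝ φ (s • v) v) w)
    (w : E) : g (φ v) (fderiv ℝ φ v v) (fderiv ℝ φ v w) = B v w := by
  have hm : ∀ s ∈ Icc (0 : ℝ) 1, s • v ∈ S := fun s hs => hst.smul_mem_of_mem_Icc hv hs
  have hD2 : ∀ s ∈ Icc (0 : ℝ) 1,
      HasFDerivAt (fderiv ℝ φ) (fderiv ℝ (fderiv ℝ φ) (s • v)) (s • v) := fun s hs =>
    (((hφ.fderiv_of_isOpen (m := 1) hS (by norm_cast)).differentiableOn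
      one_ne_zero).differentiableAt (hS.mem_nhds (hm s hs))).hasFDerivAt
  have hgs : ∀ s ∈ Icc (0 : ℝ) 1, HasDerivAt (fun s : ℝ => g (φ (s • v)))
      (fderiv ℝ g (φ (s • v)) (fderiv ℝ φ (s • v) v)) s := fun s hs => by
    have hl : HasDerivAt (fun s : ℝ => s • v) v s := by
      simpa using (hasDerivAt_id s).smul_const v
    have hD1 : HasFDerivAt φ (fderiv ℝ φ (s • v)) (s • v) :=
      ((hφ.differentiableOn (by simp)).differentiableAt (hS.mem_nhds (hm s hs))).hasFDerivAt
    exact HasFDerivAt.comp_hasDerivAt s (hg _ (hm s hs)) (hD1.comp_hasDerivAt s hl)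
  -- With the Jacobi field `J(s) = s Dφ(s v) w`, the function `g(γ', J) - s B(v, w)` has derivative
  -- zero: the weak geodesic equation replaces `g(γ'', J)`, and the rest is half of the variation
  -- identity. It vanishes at `s = 0`; at `s = 1` this is the claim.
  have hder : ∀ s ∈ Icc (0 : ℝ) 1, HasDerivAt (fun s : ℝ =>
      g (φ (s • v)) (fderiv ℝ φ (s • v) v) (s • fderiv ℝ φ (s • v) w) - s * B v w) 0 s := by
    intro s hs
    have h1 : HasDerivAt (fun s : ℝ => s • fderiv ℝ φ (s • v) w)
        (s • fderiv ℝ (fderiv ℝ φ) (s • v) v w + (1 : ℝ) • fderiv ℝ φ (s • v) w) s :=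
      (hasDerivAt_id s).fun_smul ((hD2 s hs).hasDerivAt_ray_apply w)
    have h2 := ((hgs s hs).clm_apply ((hD2 s hs).hasDerivAt_ray_apply v)).clm_apply h1
    have h3 := (hasDerivAt_id s).mul_const (B v w)
    refine (h2.sub h3).congr_deriv ?_
    have hvar := fderiv_speed_variation hS hst hφ hg hsymm hB hspeed hv w hs
    rw [add_apply, hweak s hs, one_smul, add_comm (s • fderiv ℝ (fderiv ℝ φ) (s • v) v w)]
    linarith
  have h := eq_of_hasDerivAt_zero_Ioo zero_le_one
    (fun s hs => (hder s hs).continuousAt.continuousWithinAt)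
    fun s hs => hder s (Ioo_subset_Icc_self hs)
  simp only [zero_smul, map_zero, zero_mul, sub_zero, one_smul, one_mul] at h
  linarith

end GaussLemma

namespace OrdExp

/-! ### Normal charts and the gradient of the world function. -/

section NormalChart

set_option maxSynthPendingDepth 3

variable {d : ℕ}

/-- `φ` is the exponential map at `y`, a diffeomorphism onto `V`. -/
structure IsNormalChart (G : Coord d → Matrix (Fin d) (Fin d) ℝ) (V : Set (Coord d)) (y : Coord d)
    (φ : OpenPartialHomeomorph (Coord d) (Coord d)) : Prop where
  zero_mem : (0 : Coord d) ∈ φ.source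
  star : StarConvex ℝ 0 φ.source
  target_eq : φ.target = V
  map_zero : φ 0 = y
  smooth : ContDiffOn ℝ ∞ φ φ.source
  smooth_symm : ContDiffOn ℝ ∞ φ.symm φ.target
  geodesic : ∀ v ∈ φ.source, IsGeodesic G V 0 1 (fun s => φ (s • v))
  velocity_zero : ∀ v ∈ φ.source, velocity 0 1 (fun s => φ (s • v)) 0 = v

variable {G : Coord d → Matrix (Fin d) (Fin d) ℝ} {V : Set (Coord d)} {x y : Coord d}
  {φ : OpenPartialHomeomorph (Coord d) (Coord d)}

theorem IsNormalNhd.exists_chart (h : IsNormalNhd G V y) : ∃ φ, IsNormalChart G V y φ := by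
  obtain ⟨φ, h1, h2, h3, h4, h5, h6, h7⟩ := h
  exact ⟨φ, h1, h2, h3, h4, h5, h6, fun v hv => (h7 v hv).1, fun v hv => (h7 v hv).2⟩

namespace IsNormalChart

variable (hφ : IsNormalChart G V y φ) {v : Coord d}

include hφ

theorem smul_mem (hv : v ∈ φ.source) {s : ℝ} (hs : s ∈ Icc (0 : ℝ) 1) : s • v ∈ φ.source :=
  hφ.star.smul_mem_of_mem_Icc hv hs

theorem map_mem (hv : v ∈ φ.source) : φ v ∈ V := hφ.target_eq ▸ φ.map_source hv

theorem base_mem : y ∈ V := hφ.map_zero ▸ hφ.map_mem hφ.zero_mem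

theorem hasFDerivAt (hv : v ∈ φ.source) : HasFDerivAt φ (fderiv ℝ φ v) v :=
  ((hφ.smooth.differentiableOn (by simp)).differentiableAt (φ.open_source.mem_nhds hv)).hasFDerivAt

theorem hasFDerivAt_fderiv (hv : v ∈ φ.source) :
    HasFDerivAt (fderiv ℝ φ) (fderiv ℝ (fderiv ℝ φ) v) v :=
  (((hφ.smooth.fderiv_of_isOpen (m := 1) φ.open_source (by norm_cast)).differentiableOn
    one_ne_zero).differentiableAt (φ.open_source.mem_nhds hv)).hasFDerivAt

theorem velocity_eq (hv : v ∈ φ.source) {s : ℝ} (hs : s ∈ Icc (0 : ℝ) 1) :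
    velocity 0 1 (fun s => φ (s • v)) s = fderiv ℝ φ (s • v) v := by
  simpa using velocity_radial hφ.star hφ.smooth hv zero_lt_one (γ := fun s => φ (s • v))
    (fun s _ => by simp) hs

theorem gform_speed (hG : IsMetricOn G V) (hv : v ∈ φ.source) {s : ℝ} (hs : s ∈ Icc (0 : ℝ) 1) :
    gform G (φ (s • v)) (fderiv ℝ φ (s • v) v) (fderiv ℝ φ (s • v) v) = gform G y v v := by
  have h := (hφ.geodesic v hv).gform_velocity_eq hG zero_lt_one hs
  rw [hφ.velocity_eq hv hs, hφ.velocity_zero v hv] at h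
  simpa [hφ.map_zero] using h

theorem hasDerivAt_fderiv_ray (hv : v ∈ φ.source) {s : ℝ} (hs : s ∈ Icc (0 : ℝ) 1) :
    HasDerivAt (fun s : ℝ => fderiv ℝ φ (s • v) v) (fderiv ℝ (fderiv ℝ φ) (s • v) v v) s :=
  (hφ.hasFDerivAt_fderiv (hφ.smul_mem hv hs)).hasDerivAt_ray_apply v

/-- The Gauss lemma. -/
theorem gauss (hG : IsMetricOn G V) (hv : v ∈ φ.source) (w : Coord d) :
    gform G (φ v) (fderiv ℝ φ v v) (fderiv ℝ φ v w) = gform G y v w := by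
  refine gauss_of_weak_geodesic φ.open_source hφ.star hφ.smooth
    (fun v hv => hG.hasFDerivAt_gform (hφ.map_mem hv)) (fun v hv => hG.gform_symm (hφ.map_mem hv))
    (hG.gform_symm hφ.base_mem) (fun v hv s hs => hφ.gform_speed hG hv hs) hv (fun s hs w => ?_) w
  -- The acceleration prescribed by the geodesic equation is the second derivative of `φ` along the
  -- ray.
  have hacc : (geodesicField G (φ (s • v), velocity 0 1 (fun s => φ (s • v)) s)).2 =
      fderiv ℝ (fderiv ℝ φ) (s • v) v v := by
    have h1 := (hφ.geodesic v hv).hasDerivWithinAt_velocity zero_lt_one hs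
    have h2 := (hφ.hasDerivAt_fderiv_ray hv hs).hasDerivWithinAt (s := Icc 0 1)
    exact (uniqueDiffOn_Icc zero_lt_one s hs).eq_deriv _ h1
      (h2.congr (fun r hr => hφ.velocity_eq hv hr) (hφ.velocity_eq hv hs))
  have hweak := (hφ.geodesic v hv).gform_acceleration hG hs w
  rwa [hacc, hφ.velocity_eq hv hs] at hweak

theorem curveLength_eq (hG : IsMetricOn G V) (hv : v ∈ φ.source) {γ : ℝ → Coord d}
    (hγ : ∀ s ∈ Icc (0 : ℝ) 1, γ s = φ (s • v)) :
    curveLength G 0 1 γ = Real.sqrt (gform G y v v) := by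
  rw [curveLength, intervalIntegral.integral_congr (g := fun _ => Real.sqrt (gform G y v v))]
  · simp
  · intro s hs
    rw [uIcc_of_le zero_le_one] at hs
    have h1 : velocity 0 1 γ s = fderiv ℝ φ (s • v) v := by
      rw [← hφ.velocity_eq hv hs]
      exact derivWithin_congr hγ (hγ s hs)
    dsimp only
    rw [← gform_apply, h1, hγ s hs, hφ.gform_speed hG hv hs]

/-- Every geodesic in a normal neighbourhood which starts at its centre is radial. -/
theorem exists_eq_radial (hG : IsMetricOn G V) {γ : ℝ → Coord d} (hγ : IsGeodesic G V 0 1 γ)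
    (h0 : γ 0 = y) :
    velocity 0 1 γ 0 ∈ φ.source ∧
      ∀ s ∈ Icc (0 : ℝ) 1, γ s = φ (s • velocity 0 1 γ 0) := by
  set v := velocity 0 1 γ 0 with hvdef
  -- The rescaled geodesic `s ↦ γ(T s)` has initial velocity `T v`; if `T v` lies in the source, it
  -- coincides with a ray by uniqueness.
  have hstep : ∀ T ∈ Icc (0 : ℝ) 1, T • v ∈ φ.source → γ T = φ (T • v) := by
    intro T hT hTv
    have hm : ∀ s ∈ Icc (0 : ℝ) 1, T * s + 0 ∈ Icc (0 : ℝ) 1 := fun s hs => by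
      rw [add_zero]; exact ⟨mul_nonneg hT.1 hs.1, mul_le_one₀ hT.2 hs.1 hs.2⟩
    have h1 := hγ.comp_affine zero_lt_one zero_lt_one hm
    have h2 := h1.eqOn hG zero_lt_one (hφ.geodesic _ hTv) (by simp [h0, hφ.map_zero]) (by
      rw [velocity_comp_affine zero_lt_one hγ.contDiffOn hm (by simp), hφ.velocity_zero _ hTv]
      simp [hvdef]) (right_mem_Icc.2 zero_le_one)
    simpa using h2
  suffices h : Icc (0 : ℝ) 1 ⊆ {s | s • v ∈ φ.source} by
    refine ⟨by simpa using h (right_mem_Icc.2 zero_le_one), fun s hs => hstep s hs (h hs)⟩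
  -- It remains to see that the ray does not leave the source before time `1`. Since `γ` stays in
  -- the target, `φ.symm ∘ γ` is continuous, and a limit of admissible parameters has `s v = φ.symm
  -- (γ s)` in the source. Openness of the source gives the other half of the argument.
  have hcl : IsClosed ({s : ℝ | s • v ∈ φ.source} ∩ Icc (0 : ℝ) 1) := by
    refine isClosed_of_closure_subset fun s hs => ?_
    have hsI : s ∈ Icc (0 : ℝ) 1 := closure_minimal inter_subset_right isClosed_Icc hs
    refine ⟨?_, hsI⟩
    have hne := mem_closure_iff_nhdsWithin_neBot.1 hs
    set B := {s : ℝ | s • v ∈ φ.source} ∩ Icc (0 : ℝ) 1 with hB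
    have hγV : γ s ∈ φ.target := hφ.target_eq ▸ hγ.mapsTo hsI
    have h1 : Tendsto (fun r => φ.symm (γ r)) (𝓝[B] s) (𝓝 (φ.symm (γ s))) :=
      ((φ.continuousAt_symm hγV).tendsto.comp
        ((hγ.contDiffOn.continuousOn s hsI).mono inter_subset_right))
    have h2 : Tendsto (fun r : ℝ => r • v) (𝓝[B] s) (𝓝 (s • v)) :=
      (by fun_prop : Continuous fun r : ℝ => r • v).continuousAt.continuousWithinAt
    have h3 : (fun r => φ.symm (γ r)) =ᶠ[𝓝[B] s] fun r => r • v := by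
      filter_upwards [self_mem_nhdsWithin] with r hr
      rw [hstep r hr.2 hr.1, φ.left_inv hr.1]
    change s • v ∈ φ.source
    rw [← tendsto_nhds_unique (h1.congr' h3) h2]
    exact φ.map_target hγV
  refine hcl.Icc_subset_of_forall_mem_nhdsWithin (by simpa using hφ.zero_mem) ?_
  rintro s ⟨hs, -⟩
  exact mem_nhdsWithin_of_mem_nhds
    ((by fun_prop : Continuous fun r : ℝ => r • v).continuousAt (φ.open_source.mem_nhds hs))

/-- By `exists_eq_radial` and injectivity of `φ`, every competing geodesic is `s ↦ φ(s v)` on `[0,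
1]`, so the infimum is over a single length. -/
theorem geodesicDist_eq (hG : IsMetricOn G V) (hv : v ∈ φ.source) :
    geodesicDist G V (φ v) y = Real.sqrt (gform G y v v) := by
  have : {L : ℝ | ∃ γ : ℝ → Coord d, IsGeodesic G V 0 1 γ ∧ γ 0 = y ∧ γ 1 = φ v ∧
      curveLength G 0 1 γ = L} = {Real.sqrt (gform G y v v)} := by
    ext L
    rw [mem_singleton_iff]
    constructor
    · rintro ⟨γ, hγ, h0, h1, rfl⟩
      obtain ⟨hw, hγw⟩ := hφ.exists_eq_radial hG hγ h0
      have h2 := hγw 1 (by simp)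
      rw [h1, one_smul] at h2
      rw [← φ.injOn hv hw h2] at hγw
      exact hφ.curveLength_eq hG hv hγw
    · rintro rfl
      exact ⟨fun s => φ (s • v), hφ.geodesic v hv, by simp [hφ.map_zero], by simp,
        hφ.curveLength_eq hG hv fun _ _ => rfl⟩
  rw [geodesicDist, this, csInf_singleton]

theorem synge_eq (hG : IsMetricOn G V) (hv : v ∈ φ.source) :
    synge G V (φ v) y = gform G y v v / 2 := by
  rw [synge, hφ.geodesicDist_eq hG hv, Real.sq_sqrt (hG.gform_self_nonneg hφ.base_mem v)]

/-- The gradient of the world function is the final velocity of the geodesic. -/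
theorem hasFDerivAt_synge (hG : IsMetricOn G V) (hv : v ∈ φ.source) :
    HasFDerivAt (fun z => synge G V z y) (gform G (φ v) (fderiv ℝ φ v v)) (φ v) := by
  have hmem : φ v ∈ φ.target := φ.map_source hv
  have hnh := φ.open_target.mem_nhds hmem
  have hs : HasFDerivAt φ.symm (fderiv ℝ φ.symm (φ v)) (φ v) :=
    ((hφ.smooth_symm.differentiableOn (by simp)).differentiableAt hnh).hasFDerivAt
  have hinv : (fderiv ℝ φ v).comp (fderiv ℝ φ.symm (φ v)) = ContinuousLinearMap.id ℝ _ := by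
    have h1 : HasFDerivAt φ (fderiv ℝ φ v) (φ.symm (φ v)) := by
      rw [φ.left_inv hv]; exact hφ.hasFDerivAt hv
    have h2 := h1.comp (φ v) hs
    refine (h2.congr_of_eventuallyEq ?_).unique (hasFDerivAt_id _)
    filter_upwards [hnh] with z hz using (φ.right_inv hz).symm
  have he : (fun z => synge G V z y) =ᶠ[𝓝 (φ v)]
      fun z => (1 / 2) * gform G y (φ.symm z) (φ.symm z) := by
    filter_upwards [hnh] with z hz
    have := hφ.synge_eq hG (φ.map_target hz)
    rw [φ.right_inv hz] at this
    rw [this]; ring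
  -- Differentiating `g_y(φ⁻¹ z, φ⁻¹ z) / 2` gives `w ↦ g_y(v, Dφ⁻¹ w)`; the Gauss lemma moves this
  -- pairing from `y` to `φ(v)`.
  have hd := ((((hasFDerivAt_const (gform G y) (φ v)).clm_apply hs).clm_apply hs).const_mul
    (1 / 2 : ℝ))
  refine (hd.congr_of_eventuallyEq he).congr_fderiv ?_
  ext w
  have h1 := congrArg (fun L => L w) hinv
  simp only [ContinuousLinearMap.comp_apply, ContinuousLinearMap.id_apply] at h1
  conv_rhs => rw [← h1]
  rw [hφ.gauss hG hv]
  have h2 := hG.gform_symm hφ.base_mem (fderiv ℝ φ.symm (φ v) w) v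
  simp only [φ.left_inv hv, one_div, ContinuousLinearMap.comp_apply, smul_apply, add_apply,
    ContinuousLinearMap.flip_apply, smul_eq_mul]
  simp [h2]
  ring

theorem syngeLeft_eq (hG : IsMetricOn G V) (hv : v ∈ φ.source) (ρ : Fin d) :
    syngeLeft G V ρ (φ v) y = fderiv ℝ φ v v ρ := by
  have hz := hφ.map_mem hv
  have hpd : ∀ ν, pd ν (fun z => synge G V z y) (φ v) = ∑ μ, G (φ v) ν μ * fderiv ℝ φ v v μ := by
    intro ν
    rw [pd, (hφ.hasFDerivAt_synge hG hv).fderiv, gform_apply]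
    refine Finset.sum_congr rfl fun μ _ => ?_
    rw [Finset.sum_eq_single ν]
    · simp [hG.symm _ hz μ ν]
    · intro β _ hβ
      simp [hβ]
    · simp
  have hinv := Matrix.nonsing_inv_mul (G (φ v)) (hG.isUnit_det hz)
  have h1 : (G (φ v))⁻¹ *ᵥ (G (φ v) *ᵥ fun μ => fderiv ℝ φ v v μ) = fun μ => fderiv ℝ φ v v μ := by
    rw [Matrix.mulVec_mulVec, hinv, Matrix.one_mulVec]
  have h2 := congrFun h1 ρ
  rw [← h2, syngeLeft, Matrix.mulVec, dotProduct]
  refine Finset.sum_congr rfl fun ν _ => ?_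
  rw [hpd]; rfl

/-- Reversing the geodesic: the normal chart at the other end point. -/
theorem exists_reverse (hG : IsMetricOn G V) (hv : v ∈ φ.source)
    {χ : OpenPartialHomeomorph (Coord d) (Coord d)} (hχ : IsNormalChart G V (φ v) χ) :
    -fderiv ℝ φ v v ∈ χ.source ∧
      ∀ s ∈ Icc (0 : ℝ) 1, χ (s • -fderiv ℝ φ v v) = φ ((1 - s) • v) := by
  have hm : ∀ s ∈ Icc (0 : ℝ) 1, -1 * s + 1 ∈ Icc (0 : ℝ) 1 := fun s hs =>
    ⟨by linarith [hs.2], by linarith [hs.1]⟩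
  have hrev := (hφ.geodesic v hv).comp_affine zero_lt_one zero_lt_one hm
  have h := hχ.exists_eq_radial hG hrev (by simp)
  have hvel : velocity 0 1 (fun s : ℝ => φ ((-1 * s + 1) • v)) 0 = -fderiv ℝ φ v v := by
    have := velocity_comp_affine zero_lt_one (hφ.geodesic v hv).contDiffOn hm
      (left_mem_Icc.2 zero_le_one)
    rw [this, hφ.velocity_eq hv (by simp)]
    simp
  rw [hvel] at h
  refine ⟨h.1, fun s hs => ?_⟩
  rw [← h.2 s hs]
  congr 2
  ring

end IsNormalChart

/-- The reversed geodesic has initial vector `-Dφ(v)v` in the chart centred at `x`, and constancy of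
speed equates its squared norm with that of `v`. -/
theorem IsConvexDomain.synge_comm (hG : IsMetricOn G V) (hV : IsConvexDomain G V) (hx : x ∈ V)
    (hy : y ∈ V) : synge G V x y = synge G V y x := by
  obtain ⟨φ, hφ⟩ := (hV.2 y hy).exists_chart
  obtain ⟨χ, hχ⟩ := (hV.2 x hx).exists_chart
  obtain ⟨v, hv, rfl⟩ : ∃ v ∈ φ.source, φ v = x := by
    rw [← hφ.target_eq] at hx
    exact ⟨φ.symm x, φ.map_target hx, φ.right_inv hx⟩
  obtain ⟨hw, hrev⟩ := hφ.exists_reverse hG hv hχ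
  have h1 : χ (-fderiv ℝ φ v v) = y := by simpa [hφ.map_zero] using hrev 1 (by simp)
  have h2 := hχ.synge_eq hG hw
  rw [h1] at h2
  rw [hφ.synge_eq hG hv, h2]
  have h3 := hφ.gform_speed hG hv (s := 1) (by simp)
  rw [one_smul] at h3
  simp [h3]

theorem IsConvexDomain.syngeRight_eq (hG : IsMetricOn G V) (hV : IsConvexDomain G V) (hx : x ∈ V)
    (hy : y ∈ V) (ρ : Fin d) : syngeRight G V ρ x y = syngeLeft G V ρ y x := by
  have he : (fun z => synge G V x z) =ᶠ[𝓝 y] fun z => synge G V z x := by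
    filter_upwards [hV.1.mem_nhds hy] with z hz using hV.synge_comm hG hx hz
  have hsymm : (G y)⁻¹.IsSymm := by
    have : (G y).IsSymm := Matrix.IsSymm.ext fun i j => hG.symm y hy j i
    exact this.inv
  refine Finset.sum_congr rfl fun ν _ => ?_
  rw [pd, pd, he.fderiv_eq, mul_comm, hsymm.apply]

end NormalChart

end OrdExp

namespace OrdExp

/-! ### The metric and the connection in a chart of the manifold. -/

section MetricCoord

variable {d : ℕ} {M : Type*} [TopologicalSpace M] [ChartedSpace (Coord d) M]
  {e : OpenPartialHomeomorph M (Coord d)}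

/-- This is the tangent map of `e.symm` composed with a constant vector field. It makes the
coordinate fields smooth, as needed for smoothness of the metric components. -/
theorem contMDiffOn_mfderiv_symm_apply [IsManifold (𝓡 d) ∞ M]
    (he : e ∈ IsManifold.maximalAtlas (𝓡 d) ∞ M)
    (w : Coord d) :
    ContMDiffOn (𝓡 d) ((𝓡 d).prod 𝓘(ℝ, Coord d)) ∞
      (fun z => Bundle.TotalSpace.mk' (Coord d) (E := (TangentSpace (𝓡 d) : M → Type _))
        (e.symm z) (mfderiv (𝓡 d) (𝓡 d) e.symm z w)) e.target := by
  have hs : UniqueMDiffOn (𝓡 d) e.target := e.open_target.uniqueMDiffOn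
  have h1 := (contMDiffOn_symm_of_mem_maximalAtlas he).contMDiffOn_tangentMapWithin
    (m := ∞) (by simp) hs
  have h2 : ContMDiffOn (𝓡 d) ((𝓡 d).prod 𝓘(ℝ, Coord d)) ∞
      (fun z => Bundle.TotalSpace.mk' (Coord d) (E := (TangentSpace (𝓡 d) : Coord d → Type _))
        z w) e.target :=
    contMDiffOn_vectorSpace_iff_contDiffOn.2 contDiffOn_const
  refine (h1.comp h2 fun z hz => hz).congr fun z hz => ?_
  simp only [Function.comp_def, tangentMapWithin]
  rw [mfderivWithin_of_isOpen e.open_target hz]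

theorem injective_mfderiv_symm (he : e ∈ IsManifold.maximalAtlas (𝓡 d) ∞ M) {z : Coord d}
    (hz : z ∈ e.target) : Function.Injective (mfderiv (𝓡 d) (𝓡 d) e.symm z) := by
  have h : e.MDifferentiable (𝓡 d) (𝓡 d) :=
    ⟨(contMDiffOn_of_mem_maximalAtlas he).mdifferentiableOn (by simp),
      (contMDiffOn_symm_of_mem_maximalAtlas he).mdifferentiableOn (by simp)⟩
  exact (h.symm.mfderiv_bijective hz).injective

theorem contDiffOn_adjMatrix_comp_symm {ι : Type*} [Fintype ι] {𝔤 : Type*} [LieRing 𝔤]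
    [LieAlgebra ℝ 𝔤] (t : Module.Basis ι ℝ 𝔤) (he : e ∈ IsManifold.maximalAtlas (𝓡 d) ∞ M)
    {U : Set M} (hU : U ⊆ e.source) {b : M → 𝔤}
    (hb : ∀ a, ContMDiffOn (𝓡 d) 𝓘(ℝ, ℝ) ∞ (fun p => t.repr (b p) a) U) (i j : ι) :
    ContDiffOn ℝ ∞ (fun z => adjMatrix t (b (e.symm z)) i j) (e '' U) := by
  have hV : e '' U ⊆ e.target := (image_mono hU).trans e.image_source_eq_target.subset
  refine ContDiffOn.sum fun k _ => contDiffOn_const.mul ?_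
  rw [← contMDiffOn_iff_contDiffOn]
  refine (hb k).comp ((contMDiffOn_symm_of_mem_maximalAtlas he).mono hV) ?_
  rintro _ ⟨p, hp, rfl⟩
  simpa [e.left_inv (hU hp)] using hp

variable [IsManifold (𝓡 d) ∞ M] (g : Bundle.ContMDiffRiemannianMetric (𝓡 d) ∞ (Coord d)
  (TangentSpace (𝓡 d) : M → Type _))

theorem gform_metricCoord (z u w : Coord d) :
    gform (metricCoord g e) z u w = g.inner (e.symm z)
      (mfderiv (𝓡 d) (𝓡 d) e.symm z u) (mfderiv (𝓡 d) (𝓡 d) e.symm z w) := by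
  have hL : ∀ v : Coord d, mfderiv (𝓡 d) (𝓡 d) e.symm z v =
      ∑ μ, v μ • mfderiv (𝓡 d) (𝓡 d) e.symm z (EuclideanSpace.single μ (1 : ℝ)) := fun v => by
    conv_lhs => rw [coord_eq_sum v]
    exact (map_sum (mfderiv (𝓡 d) (𝓡 d) e.symm z) _ _).trans
      (Finset.sum_congr rfl fun μ _ => map_smul (mfderiv (𝓡 d) (𝓡 d) e.symm z) _ _)
  rw [hL u, hL w, gform_apply]
  simp only [map_sum, map_smul, sum_apply, smul_apply, smul_eq_mul, metricCoord,
    Matrix.of_apply]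
  rw [Finset.sum_comm]
  refine Finset.sum_congr rfl fun ν _ => ?_
  rw [Finset.mul_sum]
  exact Finset.sum_congr rfl fun μ _ => by ring

theorem isMetricOn_metricCoord (he : e ∈ IsManifold.maximalAtlas (𝓡 d) ∞ M) {V : Set (Coord d)}
    (hV : IsOpen V) (hVe : V ⊆ e.target) : IsMetricOn (metricCoord g e) V where
  isOpen := hV
  smooth μ ν := by
    rw [← contMDiffOn_iff_contDiffOn]
    intro z hz
    have hb := contMDiffOn_symm_of_mem_maximalAtlas he z (hVe hz)
    have h : ContMDiffWithinAt (𝓡 d) ((𝓡 d).prod 𝓘(ℝ)) ∞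
        (fun z => Bundle.TotalSpace.mk' ℝ (E := Bundle.Trivial M ℝ) (e.symm z)
          (g.inner (e.symm z)
      (mfderiv (𝓡 d) (𝓡 d) e.symm z (EuclideanSpace.single μ (1 : ℝ)))
      (mfderiv (𝓡 d) (𝓡 d) e.symm z (EuclideanSpace.single ν (1 : ℝ))))) e.target z := by
      apply ContMDiffWithinAt.clm_bundle_apply₂ (F₁ := Coord d) (F₂ := Coord d)
      · exact ContMDiffAt.comp_contMDiffWithinAt z g.contMDiff.contMDiffAt hb
      · exact contMDiffOn_mfderiv_symm_apply he _ z (hVe hz)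
      · exact contMDiffOn_mfderiv_symm_apply he _ z (hVe hz)
    simp only [Bundle.contMDiffWithinAt_totalSpace] at h
    exact h.2.mono hVe
  symm z hz μ ν := g.symm _ _ _
  pos z hz u hu := by
    rw [gform_metricCoord]
    refine g.pos _ _ fun h0 => hu (injective_mfderiv_symm he (hVe hz) ?_)
    rw [h0]
    exact (map_zero (mfderiv (𝓡 d) (𝓡 d) e.symm z)).symm

end MetricCoord

end OrdExp

namespace OrdExp

/-! ### Transposition, the left operator and the reversed geodesic. -/

section Transpose

variable {d : ℕ} {ι : Type*}
  {G : Coord d → Matrix (Fin d) (Fin d) ℝ} {V : Set (Coord d)}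
  {A : Fin d → Coord d → Matrix ι ι ℝ}

theorem IsOperatorExp.transpose {N N' : (Coord d → Matrix ι ι ℝ) → Coord d → Matrix ι ι ℝ}
    {h : Coord d → Matrix ι ι ℝ} {u : ℝ → Coord d → Matrix ι ι ℝ} (hu : IsOperatorExp V N h u)
    (hN : ∀ f, ∀ z ∈ V, N' (fun w => (f w)ᵀ) z = (N f z)ᵀ) :
    IsOperatorExp V N' (fun z => (h z)ᵀ) (fun τ z => (u τ z)ᵀ) where
  contDiffOn i j := hu.contDiffOn j i
  init z hz := by rw [hu.init z hz]
  evol τ hτ z hz i j := by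
    rw [hN _ z hz]
    exact hu.evol τ hτ z hz j i

variable [Fintype ι]

theorem covRight_eq_transpose (ρ : Fin d) (h : Coord d → Matrix ι ι ℝ) (z : Coord d) :
    covRight A ρ h z = (covLeft (fun μ w => -(A μ w)ᵀ) ρ (fun w => (h w)ᵀ) z)ᵀ := by
  rw [covRight, covLeft, neg_mul, ← Matrix.transpose_mul, sub_eq_add_neg]
  rfl

theorem Nr_eq_vectorOp (y : Coord d) :
    Nr G V A y = vectorOp A (fun ρ z => syngeLeft G V ρ z y) := rfl

/-- Transposition reverses products, so right multiplication by `-A` becomes left multiplication by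
`-Aᵀ`: the uniqueness and limit results for `N_r` with the dual connection apply. -/
theorem Nl_eq_transpose {x y : Coord d} (h : Coord d → Matrix ι ι ℝ)
    (hσ : ∀ ρ, syngeRight G V ρ x y = syngeLeft G V ρ y x) :
    Nl G V A x h y = (Nr G V (fun μ w => -(A μ w)ᵀ) x (fun w => (h w)ᵀ) y)ᵀ := by
  simp only [Nl, Nr, hσ, covRight_eq_transpose, Matrix.transpose_sum, Matrix.transpose_smul]

variable [DecidableEq ι]

/-- Parallel transport along a ray of a chart. -/
theorem hasDerivAt_transport_ray {φ : Coord d → Coord d} {S : Set (Coord d)} (hS : IsOpen S)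
    {P : Coord d → Matrix ι ι ℝ} (hP : ∀ i j, ContDiffOn ℝ 1 (fun v => P v i j) S)
    (hPd : ∀ v ∈ S, ∀ i j, fderiv ℝ (fun v => P v i j) v v =
      -((∑ μ, fderiv ℝ φ v v μ • A μ (φ v)) * P v) i j) {v : Coord d} {s : ℝ} (hs : s ≠ 0)
    (hsv : s • v ∈ S) (i j : ι) :
    HasDerivAt (fun r : ℝ => P (r • v) i j)
      (-((∑ μ, fderiv ℝ φ (s • v) v μ • A μ (φ (s • v))) * P (s • v)) i j) s := by
  refine (hasDerivAt_ray hs (((hP i j).differentiableOn one_ne_zero).differentiableAt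
    (hS.mem_nhds hsv))).congr_deriv ?_
  have e : ∑ μ, fderiv ℝ φ (s • v) (s • v) μ • A μ (φ (s • v)) =
      s • ∑ μ, fderiv ℝ φ (s • v) v μ • A μ (φ (s • v)) := by
    simp [map_smul, Finset.smul_sum, smul_smul]
  rw [hPd _ hsv, e, smul_mul_assoc, Matrix.smul_apply, smul_eq_mul, smul_eq_mul, mul_neg,
    ← mul_assoc, inv_mul_cancel₀ hs, one_mul]

/-- Transport along the reversed geodesic by the dual connection is the transpose. -/
theorem IsNormalChart.transport_reverse {y : Coord d}
    {φ χ : OpenPartialHomeomorph (Coord d) (Coord d)} (hG : IsMetricOn G V)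
    (hφ : IsNormalChart G V y φ) {v : Coord d} (hv : v ∈ φ.source)
    (hχ : IsNormalChart G V (φ v) χ) {P Q : Coord d → Matrix ι ι ℝ}
    (hP0 : P 0 = 1) (hP : ∀ i j, ContDiffOn ℝ 1 (fun v => P v i j) φ.source)
    (hPd : ∀ v ∈ φ.source, ∀ i j, fderiv ℝ (fun v => P v i j) v v =
      -((∑ μ, fderiv ℝ φ v v μ • A μ (φ v)) * P v) i j)
    (hQ0 : Q 0 = 1) (hQ : ∀ i j, ContDiffOn ℝ 1 (fun v => Q v i j) χ.source)
    (hQd : ∀ v ∈ χ.source, ∀ i j, fderiv ℝ (fun v => Q v i j) v v =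
      -((∑ μ, fderiv ℝ χ v v μ • -(A μ (χ v))ᵀ) * Q v) i j) :
    (Q (-fderiv ℝ φ v v))ᵀ = P v := by
  obtain ⟨hw, hrev⟩ := hφ.exists_reverse hG hv hχ
  set w := -fderiv ℝ φ v v with hwdef
  have hsymm : ∀ s ∈ Icc (0 : ℝ) 1, 1 - s ∈ Icc (0 : ℝ) 1 := fun s hs =>
    ⟨by linarith [hs.2], by linarith [hs.1]⟩
  ext i j
  -- The sum is the entry of `Q(s w)ᵀ P((1-s) v)`, a pairing of two transports evaluated at the same
  -- point of the geodesic. It equals `P(v)` at `s = 0` and `Q(w)ᵀ` at `s = 1`, and duality of the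
  -- connections makes it constant.
  have hc : ContinuousOn (fun s : ℝ => ∑ k, Q (s • w) k i * P ((1 - s) • v) k j) (Icc 0 1) := by
    refine continuousOn_finsetSum _ fun k _ => ContinuousOn.mul ?_ ?_
    · exact (hQ k i).continuousOn.comp (by fun_prop) fun s hs => hχ.smul_mem hw hs
    · exact (hP k j).continuousOn.comp (f := fun s : ℝ => (1 - s) • v) (by fun_prop)
        fun s hs => hφ.smul_mem hv (hsymm s hs)
  have hd : ∀ s ∈ Ioo (0 : ℝ) 1,
      HasDerivAt (fun s : ℝ => ∑ k, Q (s • w) k i * P ((1 - s) • v) k j) 0 s := by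
    intro s hs
    have hsI := Ioo_subset_Icc_self hs
    have hsw := hχ.smul_mem hw hsI
    have hsv := hφ.smul_mem hv (hsymm s hsI)
    have hsub : HasDerivAt (fun s : ℝ => 1 - s) (-1) s := by
      simpa using (hasDerivAt_id s).const_sub 1
    -- Differentiation of the identity between the two parametrizations of the geodesic: the
    -- velocities are opposite.
    have hvel : fderiv ℝ χ (s • w) w = -fderiv ℝ φ ((1 - s) • v) v := by
      have h1 : HasDerivAt (fun r : ℝ => χ (r • w)) (fderiv ℝ χ (s • w) w) s :=
        (hχ.hasFDerivAt hsw).comp_hasDerivAt s (by simpa using (hasDerivAt_id s).smul_const w)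
      have h2 : HasDerivAt (fun r : ℝ => φ ((1 - r) • v)) (fderiv ℝ φ ((1 - s) • v) (-v)) s :=
        (hφ.hasFDerivAt hsv).comp_hasDerivAt s (by simpa using hsub.smul_const v)
      rw [← map_neg]
      refine h1.unique (h2.congr_of_eventuallyEq ?_)
      filter_upwards [Icc_mem_nhds hs.1 hs.2] with r hr using hrev r hr
    set K := ∑ μ, fderiv ℝ φ ((1 - s) • v) v μ • A μ (φ ((1 - s) • v)) with hK
    have hKt : ∑ μ, fderiv ℝ χ (s • w) w μ • -(A μ (χ (s • w)))ᵀ = Kᵀ := by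
      rw [hvel, hrev s hsI, hK, Matrix.transpose_sum]
      simp
    have hQ' : ∀ k, HasDerivAt (fun r : ℝ => Q (r • w) k i) (-(Kᵀ * Q (s • w)) k i) s := fun k => by
      rw [← hKt]
      exact hasDerivAt_transport_ray (A := fun μ z => -(A μ z)ᵀ) χ.open_source hQ hQd hs.1.ne'
        hsw k i
    have hP' : ∀ k, HasDerivAt (fun r : ℝ => P ((1 - r) • v) k j) ((K * P ((1 - s) • v)) k j) s :=
      fun k => by
        have := (hasDerivAt_transport_ray φ.open_source hP hPd (sub_pos.2 hs.2).ne' hsv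
          k j).comp s hsub
        rw [mul_neg_one, neg_neg] at this
        exact this
    refine (HasDerivAt.fun_sum fun k _ => (hQ' k).mul (hP' k)).congr_deriv ?_
    have e : -((Kᵀ * Q (s • w))ᵀ * P ((1 - s) • v)) + (Q (s • w))ᵀ * (K * P ((1 - s) • v)) = 0 := by
      rw [Matrix.transpose_mul, Matrix.transpose_transpose, Matrix.mul_assoc, neg_add_cancel]
    have e' := congrFun (congrFun e i) j
    rw [Matrix.add_apply, Matrix.neg_apply, Matrix.mul_apply, Matrix.mul_apply,
      ← Finset.sum_neg_distrib, ← Finset.sum_add_distrib] at e'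
    rw [← Matrix.zero_apply (α := ℝ) i j, ← e']
    refine Finset.sum_congr rfl fun k _ => ?_
    rw [Matrix.transpose_apply, Matrix.transpose_apply, neg_mul]
  have h := eq_of_hasDerivAt_zero_Ioo zero_le_one hc hd
  simp only [zero_smul, one_smul, sub_zero, sub_self, hP0, hQ0, Matrix.one_apply] at h
  simpa using h.symm

/-- The ordered exponential along the geodesic of a convex domain as a limit of the operator
exponentials. -/
theorem IsConvexDomain.tendsto_orderedExp (hG : IsMetricOn G V) (hV : IsConvexDomain G V)
    (hA : ∀ μ i j, ContDiffOn ℝ ∞ (fun z => A μ z i j) V) {a b : ℝ} (hab : a < b)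
    {γ : ℝ → Coord d} (hγ : IsGeodesic G V a b γ) :
    Summable (orderedExpTerm A a b γ) ∧
    (∃ u : ℝ → Coord d → Matrix ι ι ℝ,
      IsOperatorExp V (Nr G V A (γ a)) (fun _ => 1) u ∧
      (∀ w, IsOperatorExp V (Nr G V A (γ a)) (fun _ => 1) w →
        ∀ τ ≤ 0, ∀ z ∈ V, w τ z = u τ z) ∧
      Tendsto (fun s : ℝ => u (Real.log (1 - s)) (γ b)) (𝓝[<] 1) (𝓝 (orderedExp A a b γ))) ∧
    (∃ u : ℝ → Coord d → Matrix ι ι ℝ,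
      IsOperatorExp V (Nl G V A (γ b)) (fun _ => 1) u ∧
      (∀ w, IsOperatorExp V (Nl G V A (γ b)) (fun _ => 1) w →
        ∀ τ ≤ 0, ∀ z ∈ V, w τ z = u τ z) ∧
      Tendsto (fun s : ℝ => u (Real.log (1 - s)) (γ a)) (𝓝[<] 1) (𝓝 (orderedExp A a b γ))) := by
  have hba : b - a ≠ 0 := (sub_pos.2 hab).ne'
  have hya : γ a ∈ V := hγ.mapsTo (left_mem_Icc.2 hab.le)
  have hxb : γ b ∈ V := hγ.mapsTo (right_mem_Icc.2 hab.le)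
  obtain ⟨φ, hφ⟩ := (hV.2 _ hya).exists_chart
  obtain ⟨χ, hχ⟩ := (hV.2 _ hxb).exists_chart
  -- The geodesic is rescaled to `[0, 1]`, where it is a ray of the normal chart at its initial
  -- point.
  have hm : ∀ s ∈ Icc (0 : ℝ) 1, (b - a) * s + a ∈ Icc a b := fun s hs =>
    ⟨by nlinarith [hs.1], by nlinarith [hs.2]⟩
  obtain ⟨hv, hrad⟩ := hφ.exists_eq_radial hG (hγ.comp_affine hab zero_lt_one hm) (by simp)
  set v := velocity 0 1 (fun s => γ ((b - a) * s + a)) 0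
  have hγv : ∀ s ∈ Icc a b, γ s = φ (((s - a) / (b - a)) • v) := fun s hs => by
    rw [← hrad _ (div_sub_mem_Icc hab hs), mul_div_cancel₀ _ hba, sub_add_cancel]
  have hx : γ b = φ v := by
    simpa [div_self hba] using hγv b (right_mem_Icc.2 hab.le)
  rw [hx] at hχ hxb ⊢
  obtain ⟨hw, hrev⟩ := hφ.exists_reverse hG hv hχ
  have hy : χ (-fderiv ℝ φ v v) = γ a := by simpa [hφ.map_zero] using hrev 1 (by simp)
  have hA' : ∀ μ i j, ContDiffOn ℝ ∞ (fun z => (-(A μ z)ᵀ) i j) V := fun μ i j => (hA μ j i).neg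
  obtain ⟨P, ⟨u, hu, hu', hul⟩, hP0, hP, hPd, hPs⟩ := exists_radial_transport
    hφ.zero_mem hφ.star hφ.smooth hφ.smooth_symm
    (X := fun ρ z => syngeLeft G V ρ z (γ a)) (fun v hv ρ => hφ.syngeLeft_eq hG hv ρ)
    (hφ.target_eq.symm ▸ hA)
  obtain ⟨Q, ⟨w, hw1, hw', hwl⟩, hQ0, hQ, hQd, -⟩ := exists_radial_transport
    hχ.zero_mem hχ.star hχ.smooth hχ.smooth_symm
    (X := fun ρ z => syngeLeft G V ρ z (φ v)) (fun v hv ρ => hχ.syngeLeft_eq hG hv ρ)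
    (hχ.target_eq.symm ▸ hA')
  rw [hφ.target_eq, ← Nr_eq_vectorOp] at hu hu'
  rw [hχ.target_eq, ← Nr_eq_vectorOp] at hw1 hw'
  have hsum := hPs v hv a b hab γ hγv
  have hσ : ∀ z ∈ V, ∀ ρ, syngeRight G V ρ (φ v) z = syngeLeft G V ρ z (φ v) :=
    fun z hz ρ => hV.syngeRight_eq hG hxb hz ρ
  have hlim := hwl _ hw
  rw [hy] at hlim
  rw [orderedExp, hsum.tsum_eq]
  refine ⟨hsum.summable, ⟨u, hu, hu', hul v hv⟩, fun τ z => (w τ z)ᵀ, ?_, ?_, ?_⟩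
  · have := hw1.transpose (N' := Nl G V A (φ v)) fun f z hz => by
      rw [Nl_eq_transpose _ (hσ z hz)]
      simp
    simpa using this
  · intro w₂ hw₂ τ hτ z hz
    have := hw₂.transpose (N' := Nr G V (fun μ w => -(A μ w)ᵀ) (φ v)) fun f z hz => by
      rw [Nl_eq_transpose _ (hσ z hz), Matrix.transpose_transpose]
    have h2 := hw' _ (by simpa using this) τ hτ z hz
    exact congrArg Matrix.transpose h2
  -- The limit supplied by the chart at the end point is dual transport back to `γ a`; its transpose
  -- is the forward transport `P v`, the sum of the series.
  · rw [← hφ.transport_reverse hG hv hχ hP0 hP hPd hQ0 hQ hQd]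
    exact (continuous_id.matrix_transpose.tendsto _).comp hlim

end Transpose

end OrdExp

theorem lemma2
    -- the Lie algebra, its generators and their normalization by the Killing form
    {ι : Type*} [Fintype ι] [DecidableEq ι]
    {𝔤 : Type*} [LieRing 𝔤] [LieAlgebra ℝ 𝔤] (t : Module.Basis ι ℝ 𝔤)
    (ht : ∀ a b, killingForm ℝ 𝔤 (t a) (t b) = if a = b then -2 else 0)
    -- the Riemannian manifold and the convex coordinate domain
    {d : ℕ} {M : Type*} [TopologicalSpace M] [ChartedSpace (OrdExp.Coord d) M]
    [IsManifold (𝓡 d) ∞ M]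
    (g : Bundle.ContMDiffRiemannianMetric (𝓡 d) ∞ (OrdExp.Coord d)
      (TangentSpace (𝓡 d) : M → Type _))
    (e : OpenPartialHomeomorph M (OrdExp.Coord d))
    (he : e ∈ IsManifold.maximalAtlas (𝓡 d) ∞ M)
    (U : Set M) (hUe : U ⊆ e.source)
    (hU : OrdExp.IsConvexDomain (OrdExp.metricCoord g e) (e '' U))
    -- the components of the connection
    (B : Fin d → M → 𝔤)
    (hB : ∀ μ a, ContMDiffOn (𝓡 d) 𝓘(ℝ, ℝ) ∞ (fun p => t.repr (B μ p) a) U)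
    -- two points and the geodesic between them
    (x y : M) (hx : x ∈ U) (hy : y ∈ U)
    (u₀ u₁ : ℝ) (hu : u₀ < u₁) (γ : ℝ → M)
    (hγU : ∀ s ∈ Icc u₀ u₁, γ s ∈ U) (hγ₀ : γ u₀ = y) (hγ₁ : γ u₁ = x)
    (hγ : OrdExp.IsGeodesic (OrdExp.metricCoord g e) (e '' U) u₀ u₁ (fun s => e (γ s))) :
    let G := OrdExp.metricCoord g e
    let V := e '' U
    let A : Fin d → OrdExp.Coord d → Matrix ι ι ℝ :=
      fun μ z => OrdExp.adjMatrix t (B μ (e.symm z))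
    let Φ := OrdExp.orderedExp A u₀ u₁ (fun s => e (γ s))
    Summable (OrdExp.orderedExpTerm A u₀ u₁ (fun s => e (γ s))) ∧
    (∃ u : ℝ → OrdExp.Coord d → Matrix ι ι ℝ,
      OrdExp.IsOperatorExp V (OrdExp.Nr G V A (e y)) (fun _ => 1) u ∧
      (∀ w, OrdExp.IsOperatorExp V (OrdExp.Nr G V A (e y)) (fun _ => 1) w →
        ∀ τ ≤ 0, ∀ z ∈ V, w τ z = u τ z) ∧
      Tendsto (fun s : ℝ => u (Real.log (1 - s)) (e x)) (𝓝[<] 1) (𝓝 Φ)) ∧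
    (∃ u : ℝ → OrdExp.Coord d → Matrix ι ι ℝ,
      OrdExp.IsOperatorExp V (OrdExp.Nl G V A (e x)) (fun _ => 1) u ∧
      (∀ w, OrdExp.IsOperatorExp V (OrdExp.Nl G V A (e x)) (fun _ => 1) w →
        ∀ τ ≤ 0, ∀ z ∈ V, w τ z = u τ z) ∧
      Tendsto (fun s : ℝ => u (Real.log (1 - s)) (e y)) (𝓝[<] 1) (𝓝 Φ)) := by
  have hV : e '' U ⊆ e.target := (image_mono hUe).trans e.image_source_eq_target.subset
  have h := hU.tendsto_orderedExp (OrdExp.isMetricOn_metricCoord g he hU.1 hV)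
    (fun μ => OrdExp.contDiffOn_adjMatrix_comp_symm t he hUe (hB μ)) hu hγ
  rw [hγ₀, hγ₁] at h
  exact h
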